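/- Let $P\in\mathbb{Q}[X_1,X_2,\dots]$ be a character polynomial. For a permutation $\sigma$ of a finite set put $P(\sigma)=P(c_1(\sigma),c_2(\sigma),\dots)$, where $c_k(\sigma)$ is the number of $k$-cycles of $\sigma$. Let $q$ be a prime power. For $n\ge 0$ let $\mathcal{T}_n(\mathbb{F}_q)$ be the set of maximal tori of $\mathrm{GL}_n$ defined over $\mathbb{F}_q$, i.e. the maximal diagonalizable subgroups $T$ of $\mathrm{GL}_n(\overline{\mathbb{F}}_q)$ that are stable under $\mathrm{Gal}(\overline{\mathbb{F}}_q/\mathbb{F}_q)$. Such a $T$ preserves exactly $n$ lines $L_1,\dots,L_n$ in $\overline{\mathbb{F}}_q{}^{n}$; the Frobenius map $x\mapsto x^q$ permutes them by a permutation $\sigma_T$, and we put $P(T)=P(\sigma_T)$. Let $I_n\subset\mathbb{Q}[x_1,\dots,x_n]$ be the ideal generated by the symmetric polynomials with zero constant term, and let $R_i[x_1,\dots,x_n]$ be the degree-$i$ part of the coinvariant algebra $\mathbb{Q}[x_1,\dots,x_n]/I_n$, on which $S_n$ acts by permuting the variables. Let $$\langle P,R_i[x_1,\dots,x_n]\rangle=\frac1{n!}\sum_{\sigma\in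 S_n}P(\sigma)\,\chi_{R_i[x_1,\dots,x_n]}(\sigma)$$ be the inner product with the character of $R_i[x_1,\dots,x_n]$. Then for each $i\ge 0$ the number $\langle P,R_i[x_1,\dots,x_n]\rangle$ is eventually independent of $n$; denote the stable value by $$\langle P,R_i\rangle=\lim_{n\to\infty}\langle P,R_i[x_1,\dots,x_n]\rangle .$$ Moreover each set $\mathcal{T}_n(\mathbb{F}_q)$ is finite, the series $\sum_{i\ge 0}\langle P,R_i\rangle q^{-i}$ converges absolutely, and $$\lim_{n\to\infty}q^{-(n^2-n)}\sum_{T\in\mathcal{T}_n(\mathbb{F}_q)}P(T)=\sum_{i=0}^{\infty}\frac{\langle P,R_i\rangle}{q^{i}} ;$$ in particular the limit on the left exists. -/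

import Mathlib

open scoped Matrix LinearAlgebra.Projectivization

noncomputable section

/-! ## Character polynomials -/

/-- The number of `k`-cycles of a permutation `σ` (for `k ≥ 1`): the number of cycles
`{b | σ.SameCycle a b}` of `σ` that have exactly `k` elements. Fixed points are the `1`-cycles. -/
def cycleCount {α : Type*} (σ : Equiv.Perm α) (k : ℕ) : ℕ :=
  {c : Set α | (∃ a, c = {b | σ.SameCycle a b}) ∧ c.ncard = k}.ncard

/-- Character polynomials: elements of `ℚ[X₁, X₂, …]`. -/
abbrev CharacterPolynomial : Type := MvPolynomial ℕ+ ℚ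

/-- The value `P(c₁(σ), c₂(σ), …)` of the character polynomial `P` at a permutation `σ`. -/
def CharacterPolynomial.evalPerm (P : CharacterPolynomial) {α : Type*} (σ : Equiv.Perm α) : ℚ :=
  MvPolynomial.eval (fun k : ℕ+ => (cycleCount σ k : ℚ)) P

/-! ## The coinvariant algebra and its graded pieces -/

/-- The ideal `I_n` of `ℚ[x₁, …, x_n]` generated by the symmetric polynomials with zero constant
term. -/
def symmetricIdeal (n : ℕ) : Ideal (MvPolynomial (Fin n) ℚ) :=
  Ideal.span {f | f.IsSymmetric ∧ MvPolynomial.constantCoeff f = 0}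

/-- The coinvariant algebra `R[x₁, …, x_n] = ℚ[x₁, …, x_n] / I_n`. -/
abbrev CoinvariantAlgebra (n : ℕ) : Type := MvPolynomial (Fin n) ℚ ⧸ symmetricIdeal n

/-- The degree `i` piece `R_i[x₁, …, x_n]`: the image in the coinvariant algebra of the homogeneous
polynomials of degree `i`. -/
def coinvariantPiece (n i : ℕ) : Submodule ℚ (CoinvariantAlgebra n) :=
  (MvPolynomial.homogeneousSubmodule (Fin n) ℚ i).map
    (Ideal.Quotient.mkₐ ℚ (symmetricIdeal n)).toLinearMap

theorem symmetricIdeal_le_comap (n : ℕ) (σ : Equiv.Perm (Fin n)) :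
    symmetricIdeal n ≤ (symmetricIdeal n).comap
      (MvPolynomial.rename σ : MvPolynomial (Fin n) ℚ →ₐ[ℚ] MvPolynomial (Fin n) ℚ) := by
  refine Ideal.span_le.2 ?_
  rintro f ⟨hf, hc⟩
  refine Ideal.mem_comap.2 ?_
  rw [hf σ]
  exact Ideal.subset_span ⟨hf, hc⟩

/-- The automorphism `x_j ↦ x_{σ j}` of the coinvariant algebra. -/
def coinvariantMap (n : ℕ) (σ : Equiv.Perm (Fin n)) :
    CoinvariantAlgebra n →ₐ[ℚ] CoinvariantAlgebra n :=
  Ideal.quotientMapₐ _ (MvPolynomial.rename σ) (symmetricIdeal_le_comap n σ)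

theorem coinvariantMap_mk (n : ℕ) (σ : Equiv.Perm (Fin n)) (f : MvPolynomial (Fin n) ℚ) :
    coinvariantMap n σ (Ideal.Quotient.mk _ f) =
      Ideal.Quotient.mk _ (MvPolynomial.rename σ f) := rfl

theorem coinvariantMap_mem (n i : ℕ) (σ : Equiv.Perm (Fin n)) (x : CoinvariantAlgebra n)
    (hx : x ∈ coinvariantPiece n i) :
    (coinvariantMap n σ).toLinearMap x ∈ coinvariantPiece n i := by
  obtain ⟨f, hf, rfl⟩ := hx
  exact ⟨MvPolynomial.rename σ f,
    MvPolynomial.IsHomogeneous.rename_isHomogeneous hf, rfl⟩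

/-- The representation of `S_n` on `R_i[x₁, …, x_n]`, where `σ` acts by `x_j ↦ x_{σ j}`. -/
def coinvariantRep (n i : ℕ) :
    Representation ℚ (Equiv.Perm (Fin n)) (coinvariantPiece n i) where
  toFun σ := (coinvariantMap n σ).toLinearMap.restrict (coinvariantMap_mem n i σ)
  map_one' := by
    ext ⟨x, hx⟩
    obtain ⟨f, rfl⟩ := Ideal.Quotient.mk_surjective x
    simp [LinearMap.restrict_apply, coinvariantMap_mk]
  map_mul' σ τ := by
    ext ⟨x, hx⟩
    obtain ⟨f, rfl⟩ := Ideal.Quotient.mk_surjective x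
    simp [LinearMap.restrict_apply, coinvariantMap_mk, MvPolynomial.rename_rename]

/-- The inner product `⟨P, R_i[x₁, …, x_n]⟩` of the class function on `S_n` given by `P` with the
character of `R_i[x₁, …, x_n]` (both are rational-valued). -/
def coinvariantMultiplicity (P : CharacterPolynomial) (n i : ℕ) : ℚ :=
  (∑ σ : Equiv.Perm (Fin n), P.evalPerm σ * (coinvariantRep n i).character σ) / (n.factorial : ℚ)

/-- The stable multiplicity `⟨P, R_i⟩ = lim_{n → ∞} ⟨P, R_i[x₁, …, x_n]⟩`. -/
def stableMultiplicity (P : CharacterPolynomial) (i : ℕ) : ℚ :=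
  Filter.limUnder Filter.atTop (fun n => coinvariantMultiplicity P n i)

/-! ## Maximal tori of `GL_n` over a field

Below `k` is a field, `K = AlgebraicClosure k`, and an algebraic group over `k` (a finite field in
the application, so perfect) that is a closed subgroup of `GL_n` is given by its group of
`K`-points, a subgroup of `GL_n(K)` which is stable under `Gal(K/k)`. -/

/-- A subgroup of `GL_n(K)` is diagonalizable if some conjugate of it consists of diagonal
matrices. -/
def IsDiagonalizableSubgroup {n : ℕ} {K : Type*} [Field K] (T : Subgroup (GL (Fin n) K)) : Prop :=
  ∃ g : GL (Fin n) K, ∀ t ∈ T, ((g * t * g⁻¹ : GL (Fin n) K) : Matrix (Fin n) (Fin n) K).IsDiag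

/-- The set `𝓣_n(k)` of maximal tori of `GL_n` defined over `k`: the subgroups of `GL_n(K)` that
are maximal among the diagonalizable ones (these are the conjugates of the group of all diagonal
matrices, so they are automatically Zariski closed and connected), and that are defined over `k`,
that is, stable under the Galois group of `K` over `k`. -/
@[ext]
structure MaximalTorus (k : Type*) [Field k] (n : ℕ) where
  /-- The group of points over the algebraic closure. -/
  points : Subgroup (GL (Fin n) (AlgebraicClosure k))
  isMaximal : Maximal IsDiagonalizableSubgroup points
  isDefined : ∀ τ : AlgebraicClosure k ≃ₐ[k] AlgebraicClosure k,
    points.map (Matrix.GeneralLinearGroup.map (τ : AlgebraicClosure k →+* AlgebraicClosure k))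
      = points

/-- The coordinatewise action of a field automorphism `τ` on `K^n`, as a `τ`-semilinear map. -/
def semilinearAct {k K : Type*} [Field k] [Field K] [Algebra k K] (n : ℕ) (τ : K ≃ₐ[k] K) :
    (Fin n → K) →ₛₗ[(τ : K →+* K)] (Fin n → K) where
  toFun v j := τ (v j)
  map_add' v w := by ext j; simp
  map_smul' a v := by ext j; simp

theorem semilinearAct_injective {k K : Type*} [Field k] [Field K] [Algebra k K] (n : ℕ)
    (τ : K ≃ₐ[k] K) : Function.Injective (semilinearAct n τ) := fun v w h => by
  ext j
  exact τ.injective (congrFun h j)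

/-- The action of a field automorphism `τ` on the lines in `K^n`. -/
def lineAct {k K : Type*} [Field k] [Field K] [Algebra k K] (n : ℕ) (τ : K ≃ₐ[k] K) :
    Equiv.Perm (ℙ K (Fin n → K)) where
  toFun := Projectivization.map (semilinearAct n τ) (semilinearAct_injective n τ)
  invFun := Projectivization.map (semilinearAct n τ.symm) (semilinearAct_injective n τ.symm)
  left_inv L := by
    induction L using Projectivization.ind with
    | h v hv =>
      simp only [Projectivization.map_mk]
      congr 1
      ext j
      simp [semilinearAct]
  right_inv L := by
    induction L using Projectivization.ind with
    | h v hv =>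
      simp only [Projectivization.map_mk]
      congr 1
      ext j
      simp [semilinearAct]

/-- The set `𝓛_T = {L₁, …, L_n}` of eigenlines of a maximal torus `T`: the lines in `K^n` that are
preserved by every element of `T`. -/
def MaximalTorus.eigenlines {k : Type*} [Field k] {n : ℕ} (T : MaximalTorus k n) :
    Set (ℙ (AlgebraicClosure k) (Fin n → AlgebraicClosure k)) :=
  {L | ∀ t ∈ T.points, ∀ v ∈ L.submodule,
    (t : Matrix (Fin n) (Fin n) (AlgebraicClosure k)) *ᵥ v ∈ L.submodule}

theorem mem_submodule_lineAct {k K : Type*} [Field k] [Field K] [Algebra k K] (n : ℕ)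
    (τ : K ≃ₐ[k] K) (L : ℙ K (Fin n → K)) (v : Fin n → K) :
    semilinearAct n τ v ∈ (lineAct n τ L).submodule ↔ v ∈ L.submodule := by
  induction L using Projectivization.ind with
  | h w hw =>
    change semilinearAct n τ v ∈ (Projectivization.mk K (semilinearAct n τ w) _).submodule ↔ _
    rw [Projectivization.submodule_mk, Projectivization.submodule_mk,
      Submodule.mem_span_singleton, Submodule.mem_span_singleton]
    constructor
    · rintro ⟨a, ha⟩
      refine ⟨τ.symm a, semilinearAct_injective n τ ?_⟩
      rw [← ha, LinearMap.map_smulₛₗ]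
      simp
    · rintro ⟨a, rfl⟩
      exact ⟨τ a, by rw [LinearMap.map_smulₛₗ]; simp⟩

theorem MaximalTorus.lineAct_mem_eigenlines {k : Type*} [Field k] {n : ℕ} (T : MaximalTorus k n)
    (τ : AlgebraicClosure k ≃ₐ[k] AlgebraicClosure k)
    (L : ℙ (AlgebraicClosure k) (Fin n → AlgebraicClosure k)) :
    lineAct n τ L ∈ T.eigenlines ↔ L ∈ T.eigenlines := by
  have key : ∀ (t : GL (Fin n) (AlgebraicClosure k)) (v : Fin n → AlgebraicClosure k),
      semilinearAct n τ ((t : Matrix (Fin n) (Fin n) (AlgebraicClosure k)) *ᵥ v) =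
        ((Matrix.GeneralLinearGroup.map
          (τ : AlgebraicClosure k →+* AlgebraicClosure k) t :
            GL (Fin n) (AlgebraicClosure k)) : Matrix (Fin n) (Fin n) (AlgebraicClosure k)) *ᵥ
          semilinearAct n τ v := by
    intro t v
    ext j
    simp [semilinearAct, Matrix.mulVec, dotProduct, map_sum]
  constructor
  · intro h t ht v hv
    rw [← mem_submodule_lineAct n τ, key]
    refine h _ ?_ _ ((mem_submodule_lineAct n τ L v).2 hv)
    have h2 := T.isDefined τ
    rw [← h2]
    exact ⟨t, ht, rfl⟩
  · intro h t ht v hv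
    obtain ⟨s, hs, rfl⟩ : t ∈ T.points.map (Matrix.GeneralLinearGroup.map
        (τ : AlgebraicClosure k →+* AlgebraicClosure k)) := by rw [T.isDefined τ]; exact ht
    obtain ⟨w, rfl⟩ : ∃ w, semilinearAct n τ w = v :=
      ⟨fun j => τ.symm (v j), by ext j; simp [semilinearAct]⟩
    rw [← key, mem_submodule_lineAct]
    exact h s hs w ((mem_submodule_lineAct n τ L w).1 hv)

/-- The permutation `σ_T` of the eigenlines of a maximal torus `T` of `GL_n` over the finite field
`F = 𝔽_q` that is induced by the Frobenius map `x ↦ x^q`. -/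
def MaximalTorus.frobeniusPerm {F : Type*} [Field F] [Fintype F] {n : ℕ} (T : MaximalTorus F n) :
    Equiv.Perm T.eigenlines :=
  (lineAct n (FiniteField.frobeniusAlgEquivOfAlgebraic F (AlgebraicClosure F))).subtypePerm
    (T.lineAct_mem_eigenlines _)

/-- The value `P(T) = P(σ_T)` of a character polynomial at a maximal torus `T`. -/
def CharacterPolynomial.evalTorus (P : CharacterPolynomial) {F : Type*} [Field F] [Fintype F]
    {n : ℕ} (T : MaximalTorus F n) : ℚ :=
  P.evalPerm T.frobeniusPerm

end

/-! Both sides come from one finite-n expression. For `t` in a ℚ-algebra put M_n(t) = ∏_{j≤n} (1 -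
t^j) · (1/n!) ∑_{w ∈ S_n} P(w) ∏_{d} (1 - t^d)⁻¹, where d runs over the cycle lengths of w; this is
`twistedMean` with empty shift.

Coinvariant side. The elementary symmetric polynomials form a regular sequence, so dividing by e_j
multiplies the graded trace of σ by 1 - t^j. On the polynomial ring itself, σ permutes the
monomials, and counting the fixed ones gives ∏_d (1 - t^d)⁻¹. Hence ⟨P, R_i[x_1,…,x_n]⟩ is the
coefficient of X^i in M_n(X) (`mk_character_coinvariantRep`, `coinvariantMultiplicity_eq_coeff`).

Torus side. Count pairs (w, basis of K^n that Frobenius permutes by w). For each w there are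
|GL_n(𝔽_q)| such bases (`card_frobenius_bases`). Each basis determines a torus, and the bases above
T number n! ∏_d (q^d - 1), with d over the cycle lengths of σ_T (`exists_fiber_equiv`,
`card_frobenius_fixed_units`). Weighting the bases by P(w)/∏_d (q^d - 1) and summing in both ways
shows that the normalized sum over tori equals M_n(1/q) (`sum_evalTorus`,
`normalized_sum_evalTorus`).

Limit. It remains to let n grow in M_n(X) coefficientwise and in M_n(1/q) numerically, and to match
the two limits. Induction on P does this without any domination argument: for constant P, M_n is
constant in n (`partitionMean_prod`), and multiplying P by X_k removes a k-cycle
(`partitionMean_count`), which expresses the new mean through the old ones and factors 1 - t^{n+j+1}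
tending to 1. The same recursion holds for t = X and for t = 1/q, so the numerical limit is the
value of the limiting power series (`exists_stable_twistedMean`). -/

noncomputable section

open Function

/-! ## Cycles of a permutation -/

/-- The set of cycles of a permutation, fixed points included. -/
abbrev PermCycle {ι : Type*} (w : Equiv.Perm ι) : Type _ := Quotient (Equiv.Perm.SameCycle.setoid w)

/-- The cycle through an element. -/
def cycleAt {ι : Type*} (w : Equiv.Perm ι) (i : ι) : PermCycle w := Quotient.mk _ i

theorem cycleAt_out {ι : Type*} {w : Equiv.Perm ι} (c : PermCycle w) : cycleAt w c.out = c :=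
  Quotient.out_eq c

theorem exists_cycleAt_eq {ι : Type*} {w : Equiv.Perm ι} (c : PermCycle w) :
    ∃ i, cycleAt w i = c :=
  ⟨c.out, cycleAt_out c⟩

/-- The length of a cycle. -/
def PermCycle.size {ι : Type*} {w : Equiv.Perm ι} (c : PermCycle w) : ℕ :=
  Nat.card {i : ι // cycleAt w i = c}

theorem PermCycle.mk_eq_iff {ι : Type*} {w : Equiv.Perm ι} {i j : ι} :
    cycleAt w i = cycleAt w j ↔ w.SameCycle i j :=
  Quotient.eq

instance {ι : Type*} [Finite ι] (w : Equiv.Perm ι) : Fintype (PermCycle w) :=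
  Fintype.ofFinite _

theorem PermCycle.size_pos {ι : Type*} [Finite ι] {w : Equiv.Perm ι} (c : PermCycle w) :
    0 < c.size := by
  have : Nonempty {i : ι // cycleAt w i = c} := ⟨c.out, cycleAt_out c⟩
  exact Nat.card_pos

/-- The multiset of the lengths of the cycles of a permutation, fixed points included. -/
def cycleSizes {ι : Type*} [Finite ι] (w : Equiv.Perm ι) : Multiset ℕ :=
  (Finset.univ : Finset (PermCycle w)).val.map PermCycle.size

theorem prod_map_cycleSizes {ι : Type*} [Finite ι] (w : Equiv.Perm ι) {A : Type*} [CommMonoid A]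
    (y : ℕ → A) : ((cycleSizes w).map y).prod = ∏ c : PermCycle w, y c.size := by
  rw [cycleSizes, Multiset.map_map]
  rfl

/-- `SameCycle` classes are subsets on the left and points of the quotient on the right; `c ↦ {b |
cycleAt w b = c}` matches them. -/
theorem cycleCount_eq_count {ι : Type*} [Finite ι] (w : Equiv.Perm ι) (k : ℕ) :
    cycleCount w k = (cycleSizes w).count k := by
  classical
  have hset (i : ι) : {b | w.SameCycle i b} = {b | cycleAt w b = cycleAt w i} := by
    ext b
    simp only [Set.mem_ofPred_eq]
    rw [PermCycle.mk_eq_iff, Equiv.Perm.sameCycle_comm]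
  rw [cycleSizes, Multiset.count_map, ← Finset.filter_val, Finset.card_val, cycleCount,
    ← Set.ncard_coe_finset]
  symm
  refine Set.ncard_congr (fun c _ => {b | cycleAt w b = c}) ?_ ?_ ?_
  · intro c hc
    obtain ⟨i, rfl⟩ := exists_cycleAt_eq c
    refine ⟨⟨i, (hset i).symm⟩, ?_⟩
    simp only [Finset.coe_filter, Finset.mem_univ, true_and, Set.mem_ofPred_eq] at hc
    rw [hc]
    rfl
  · intro c c' _ _ h
    obtain ⟨i, rfl⟩ := exists_cycleAt_eq c
    exact (Set.ext_iff.1 h i).1 rfl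
  · rintro _ ⟨⟨i, rfl⟩, hk⟩
    refine ⟨cycleAt w i, ?_, (hset i).symm⟩
    simp only [Finset.coe_filter, Finset.mem_univ, true_and, Set.mem_ofPred_eq]
    rw [← hk, hset]
    rfl

theorem PermCycle.size_mk {ι : Type*} [Fintype ι] [DecidableEq ι] (w : Equiv.Perm ι) (i : ι)
    (hi : w i ≠ i) :
    (cycleAt w i).size = (w.cycleOf i).support.card := by
  classical
  rw [PermCycle.size, Nat.card_eq_fintype_card, Fintype.card_subtype]
  congr 1
  ext j
  simp only [Finset.mem_filter, Finset.mem_univ, true_and]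
  rw [Equiv.Perm.mem_support_cycleOf_iff, PermCycle.mk_eq_iff, Equiv.Perm.sameCycle_comm]
  simp [hi]

theorem PermCycle.size_mk_of_fixed {ι : Type*} {w : Equiv.Perm ι} {i : ι}
    (hi : w i = i) : PermCycle.size (cycleAt w i) = 1 := by
  rw [PermCycle.size, Nat.card_eq_one_iff_unique]
  refine ⟨⟨fun a b => Subtype.ext ?_⟩, ⟨i, rfl⟩⟩
  have h (a : {j : ι // cycleAt w j = cycleAt w i}) : a.1 = i :=
    (PermCycle.mk_eq_iff.1 a.2).eq_of_right hi
  rw [h, h]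

/-- Nontrivial classes correspond to cycle factors through `cycleOf` of a representative, and
trivial ones to fixed points, the parts equal to 1. This gives access to the known count of
permutations of a given cycle type. -/
theorem cycleSizes_eq_parts {ι : Type*} [Fintype ι] [DecidableEq ι] (w : Equiv.Perm ι) :
    cycleSizes w = w.partition.parts := by
  classical
  rw [Equiv.Perm.parts_partition, cycleSizes,
    ← Multiset.filter_add_not (fun c : PermCycle w => w c.out ≠ c.out) Finset.univ.val,
    Multiset.map_add, Equiv.Perm.cycleType_def]
  congr 1
  · rw [← Finset.filter_val]
    have himg : w.cycleFactorsFinset =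
        (Finset.univ.filter fun c : PermCycle w => w c.out ≠ c.out).image
          (fun c => w.cycleOf c.out) := by
      ext g
      simp only [Finset.mem_image, Finset.mem_filter, Finset.mem_univ, true_and]
      constructor
      · intro hg
        obtain ⟨i, hi⟩ := (Equiv.Perm.mem_cycleFactorsFinset_iff.1 hg).1.nonempty_support
        have hgi := Equiv.Perm.cycle_is_cycleOf hi hg
        have hs : w.SameCycle (cycleAt w i).out i :=
          PermCycle.mk_eq_iff.1 (cycleAt_out _)
        have hwi : w i ≠ i := by
          have := Equiv.Perm.mem_cycleFactorsFinset_support_le hg hi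
          simpa using this
        exact ⟨cycleAt w i, fun h => hwi ((hs.apply_eq_self_iff).1 h), by
          rw [hgi, hs.cycleOf_eq]⟩
      · rintro ⟨c, hc, rfl⟩
        exact Equiv.Perm.cycleOf_mem_cycleFactorsFinset_iff.2 (by simpa using hc)
    rw [himg, Finset.image_val_of_injOn, Multiset.map_map]
    · refine Multiset.map_congr rfl fun c hc => ?_
      have hc' : w c.out ≠ c.out := by simpa using hc
      have := PermCycle.size_mk w c.out hc'
      rw [cycleAt_out] at this
      exact this
    · intro c hc c' hc' h
      simp only [Finset.coe_filter, Finset.mem_univ, true_and, Set.mem_ofPred_eq] at hc hc'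
      have : c.out ∈ (w.cycleOf c'.out).support := by
        rw [← show w.cycleOf c.out = w.cycleOf c'.out from h,
          Equiv.Perm.mem_support_cycleOf_iff]
        exact ⟨Equiv.Perm.SameCycle.rfl, by simpa using hc⟩
      rw [Equiv.Perm.mem_support_cycleOf_iff] at this
      rw [← cycleAt_out c, ← cycleAt_out c']
      exact PermCycle.mk_eq_iff.2 this.1.symm
  · rw [← Finset.filter_val]
    rw [Multiset.eq_replicate]
    constructor
    · rw [Multiset.card_map, Finset.card_val, ← Finset.card_compl]
      refine Finset.card_bij (fun c _ => c.out) ?_ ?_ ?_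
      · intro c hc; simpa using hc
      · intro c _ c' _ h
        rw [← cycleAt_out c, ← cycleAt_out c', h]
      · intro i hi
        have hi' : w i = i := by simpa using hi
        have : (cycleAt w i).out = i :=
          (PermCycle.mk_eq_iff.1 (cycleAt_out _)).eq_of_right hi'
        exact ⟨cycleAt w i, by simpa [this] using hi', this⟩
    · intro b hb
      obtain ⟨c, hc, rfl⟩ := Multiset.mem_map.1 hb
      have hc' : w c.out = c.out := by simpa using hc
      rw [← cycleAt_out c]
      exact PermCycle.size_mk_of_fixed hc'

theorem sum_cycleSizes {ι : Type*} [Fintype ι] (w : Equiv.Perm ι) :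
    (cycleSizes w).sum = Fintype.card ι := by
  classical
  rw [cycleSizes_eq_parts]
  exact w.partition.parts_sum

theorem iterate_eq_of_sameCycle {ι : Type*} [Finite ι] {w : Equiv.Perm ι} {i j : ι}
    (h : w.SameCycle i j) : ∃ m : ℕ, m < minimalPeriod w i ∧ w^[m] i = j := by
  obtain ⟨m, hm⟩ := h.exists_nat_pow_eq
  have hp : 0 < minimalPeriod w i := by
    refine minimalPeriod_pos_of_mem_periodicPts ?_
    obtain ⟨m, hm, -, h⟩ := (Equiv.Perm.SameCycle.refl w i).exists_pow_eq''
    exact ⟨m, hm, by rw [IsPeriodicPt, IsFixedPt, ← Equiv.Perm.coe_pow]; exact h⟩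
  refine ⟨m % minimalPeriod w i, Nat.mod_lt _ hp, ?_⟩
  rw [iterate_mod_minimalPeriod_eq, ← Equiv.Perm.coe_pow, hm]

theorem mk_iterate {ι : Type*} (w : Equiv.Perm ι) (m : ℕ) (i : ι) :
    cycleAt w (w^[m] i) = cycleAt w i := by
  rw [PermCycle.mk_eq_iff, ← Equiv.Perm.coe_pow]
  exact Equiv.Perm.sameCycle_pow_left.2 Equiv.Perm.SameCycle.rfl

theorem PermCycle.size_eq_minimalPeriod {ι : Type*} [Finite ι] {w : Equiv.Perm ι} (i : ι) :
    (cycleAt w i).size = minimalPeriod w i := by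
  rw [PermCycle.size, ← Nat.card_fin (minimalPeriod w i)]
  refine (Nat.card_congr (Equiv.ofBijective
    (fun m : Fin (minimalPeriod w i) => ⟨w^[m] i, mk_iterate w m i⟩) ⟨?_, ?_⟩)).symm
  · intro m m' h
    exact Fin.ext ((iterate_eq_iterate_iff_of_lt_minimalPeriod m.2 m'.2).1 (Subtype.ext_iff.1 h))
  · rintro ⟨j, hj⟩
    obtain ⟨m, hm, h⟩ := iterate_eq_of_sameCycle (PermCycle.mk_eq_iff.1 hj).symm
    exact ⟨⟨m, hm⟩, Subtype.ext h⟩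

theorem PermCycle.exists_iterate_out {ι : Type*} [Finite ι] (w : Equiv.Perm ι) (i : ι) :
    ∃ m : ℕ, m < (cycleAt w i).size ∧
      w^[m] (cycleAt w i).out = i := by
  have h : w.SameCycle (cycleAt w i).out i :=
    PermCycle.mk_eq_iff.1 (cycleAt_out _)
  have := iterate_eq_of_sameCycle h
  rwa [← PermCycle.size_eq_minimalPeriod, cycleAt_out] at this

theorem PermCycle.iterate_size_out {ι : Type*} [Finite ι] {w : Equiv.Perm ι} (c : PermCycle w) :
    w^[c.size] c.out = c.out := by
  conv_lhs => rw [← cycleAt_out c]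
  rw [PermCycle.size_eq_minimalPeriod, cycleAt_out, iterate_minimalPeriod]

theorem PermCycle.iterate_out_inj {ι : Type*} [Finite ι] {w : Equiv.Perm ι} (c : PermCycle w)
    {m m' : ℕ} (hm : m < c.size) (hm' : m' < c.size) (h : w^[m] c.out = w^[m'] c.out) : m = m' := by
  have : c.size = minimalPeriod w c.out := by
    conv_lhs => rw [← cycleAt_out c]
    exact PermCycle.size_eq_minimalPeriod _
  rw [this] at hm hm'
  exact (iterate_eq_iterate_iff_of_lt_minimalPeriod hm hm').1 h

/-! ### Equivariant families and skew products over the cycles -/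

/-- The skew product of a permutation with a family of maps. -/
def skewMap {ι X : Type*} (w : Equiv.Perm ι) (f : ι → X → X) (p : ι × X) : ι × X :=
  (w p.1, f p.1 p.2)

theorem skewMap_iterate_fst {ι X : Type*} (w : Equiv.Perm ι) (f : ι → X → X) (m : ℕ) (p : ι × X) :
    ((skewMap w f)^[m] p).1 = w^[m] p.1 := by
  induction m with
  | zero => rfl
  | succ m ih => rw [iterate_succ_apply', iterate_succ_apply', skewMap, ih]

theorem skewMap_iterate_of_equivariant {ι X : Type*} {w : Equiv.Perm ι} {f : ι → X → X} {a : ι → X}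
    (ha : ∀ i, a (w i) = f i (a i)) (m : ℕ) (i : ι) :
    (skewMap w f)^[m] (i, a i) = (w^[m] i, a (w^[m] i)) := by
  induction m with
  | zero => rfl
  | succ m ih => rw [iterate_succ_apply', iterate_succ_apply', ih, skewMap, ha]

/-- A family `a` with `a (w i) = f i (a i)` is the same thing as a choice, for each cycle of `w`, of
a fixed point of the composite of the `f i` around the cycle. -/
theorem card_equivariant {ι X : Type*} [Finite ι] (w : Equiv.Perm ι) (f : ι → X → X) :
    Nat.card {a : ι → X // ∀ i, a (w i) = f i (a i)} =
      ∏ c : PermCycle w, Nat.card {x : X // ((skewMap w f)^[c.size] (c.out, x)).2 = x} := by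
  rw [← Nat.card_pi]
  refine Nat.card_congr (Equiv.ofBijective (fun a c => ⟨a.1 c.out, ?_⟩) ⟨?_, ?_⟩)
  · rw [skewMap_iterate_of_equivariant a.2, PermCycle.iterate_size_out]
  · intro a b hab
    refine Subtype.ext (funext fun i => ?_)
    obtain ⟨m, -, hm⟩ := PermCycle.exists_iterate_out w i
    have h1 := skewMap_iterate_of_equivariant a.2 m (cycleAt w i).out
    have h2 := skewMap_iterate_of_equivariant b.2 m (cycleAt w i).out
    have h3 := Subtype.ext_iff.1 (congrFun hab (cycleAt w i))
    simp only at h3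
    rw [h3, h2] at h1
    rw [hm] at h1
    exact (Prod.ext_iff.1 h1).2.symm
  · intro x
    choose m hm hmi using PermCycle.exists_iterate_out w
    refine ⟨⟨fun i => ((skewMap w f)^[m i] ((cycleAt w i).out,
      (x (cycleAt w i)).1)).2, fun i => ?_⟩, ?_⟩
    · have hq : cycleAt w (w i) = cycleAt w i := mk_iterate w 1 i
      have key : (skewMap w f)^[m (w i)] ((cycleAt w (w i)).out,
          (x (cycleAt w (w i))).1) = (skewMap w f)^[m i + 1] ((cycleAt w i).out,
          (x (cycleAt w i)).1) := by
        have h1 := hm (w i)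
        have h2 := hmi (w i)
        rw [hq] at h1 h2 ⊢
        have h3 : w^[m i + 1] (cycleAt w i).out = w i := by
          rw [iterate_succ_apply', hmi]
        -- Either `w i` is one step further along the cycle, or `i` is the last point and `w i` is
        -- the representative; only in the second case is the fixed-point property of `x` needed.
        rcases (Nat.succ_le_of_lt (hm i)).lt_or_eq with hlt | heq
        · rw [PermCycle.iterate_out_inj _ h1 hlt (h2.trans h3.symm)]
        · have h4 : m i + 1 = (cycleAt w i).size := heq
          have h5 : m (w i) = 0 := by
            refine PermCycle.iterate_out_inj _ h1 (PermCycle.size_pos _) ?_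
            rw [h2, ← h3, h4, PermCycle.iterate_size_out]
            rfl
          rw [h5, h4, iterate_zero, id]
          refine Prod.ext ?_ (x _).2.symm
          rw [skewMap_iterate_fst, PermCycle.iterate_size_out]
      dsimp only
      rw [key, iterate_succ_apply', skewMap, skewMap_iterate_fst, hmi]
    · funext c
      refine Subtype.ext ?_
      have h1 := hm c.out
      have h2 := hmi c.out
      dsimp only
      rw [cycleAt_out] at h1 h2 ⊢
      have : m c.out = 0 := PermCycle.iterate_out_inj c h1 (PermCycle.size_pos c) h2
      rw [this]
      rfl

end

noncomputable section

/-! ## Sums over symmetric groups of functions of the cycle lengths -/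

/-- The order of the centralizer of a permutation with the given cycle lengths. -/
def centralizerOrder (m : Multiset ℕ) : ℕ :=
  m.prod * ∏ k ∈ m.toFinset, (m.count k).factorial

theorem centralizerOrder_eq {m : Multiset ℕ} {s : Finset ℕ} (hs : m.toFinset ⊆ s) :
    centralizerOrder m = m.prod * ∏ k ∈ s, (m.count k).factorial := by
  rw [centralizerOrder]
  congr 1
  refine Finset.prod_subset hs fun k _ hk => ?_
  rw [Multiset.mem_toFinset] at hk
  rw [Multiset.count_eq_zero_of_notMem hk, Nat.factorial_zero]

theorem centralizerOrder_cons (k : ℕ) (m : Multiset ℕ) :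
    centralizerOrder (k ::ₘ m) = k * (m.count k + 1) * centralizerOrder m := by
  classical
  have h1 : m.toFinset ⊆ (k ::ₘ m).toFinset := by
    rw [Multiset.toFinset_cons]; exact Finset.subset_insert _ _
  have hk : k ∈ (k ::ₘ m).toFinset := by simp
  rw [centralizerOrder_eq h1, centralizerOrder, Multiset.prod_cons,
    ← Finset.mul_prod_erase _ _ hk, ← Finset.mul_prod_erase _ _ hk, Multiset.count_cons_self,
    Nat.factorial_succ, Finset.prod_congr rfl fun j hj => by
      rw [Multiset.count_cons_of_ne (Finset.ne_of_mem_erase hj)]]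
  ring

theorem centralizerOrder_pos {m : Multiset ℕ} (hm : ∀ k ∈ m, 0 < k) : 0 < centralizerOrder m := by
  have : 0 < m.prod := Multiset.prod_pos hm
  rw [centralizerOrder]
  positivity

/-- The class-size formula for `cycleType` ignores fixed points, so the parts are split into those
at least 2 and `a` ones. The ones do not change the product and supply the factor `a !`, with `a = n
- m.sum`. -/
theorem card_cycleSizes_eq (n : ℕ) (l : n.Partition) :
    (Finset.univ.filter fun σ : Equiv.Perm (Fin n) => cycleSizes σ = l.parts).card *
      centralizerOrder l.parts = n.factorial := by
  classical
  set m := l.parts.filter (2 ≤ ·) with hm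
  set a := l.parts.count 1 with ha
  have hdec : l.parts = m + Multiset.replicate a 1 := by
    conv_lhs => rw [← Multiset.filter_add_not (2 ≤ ·) l.parts]
    rw [← hm, ha, ← Multiset.filter_eq']
    congr 1
    refine Multiset.filter_congr fun k hk => ?_
    have := l.parts_pos hk
    omega
  have hsum : m.sum + a = n := by
    have := l.parts_sum
    rw [hdec, Multiset.sum_add, Multiset.sum_replicate] at this
    simpa using this
  have h := Equiv.Perm.card_of_cycleType_mul_eq (Fin n) m
  rw [Fintype.card_fin, if_pos ⟨by omega, fun k hk => (Multiset.mem_filter.1 hk).2⟩] at h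
  rw [← h]
  congr 1
  · congr 1
    ext σ
    simp only [Finset.mem_filter, Finset.mem_univ, true_and]
    rw [cycleSizes_eq_parts]
    constructor
    · intro h
      rw [← Equiv.Perm.filter_parts_partition_eq_cycleType, h]
    · intro h
      rw [Equiv.Perm.parts_partition, ← Equiv.Perm.sum_cycleType, h, hdec, Fintype.card_fin]
      congr 2
      omega
  · have hs : l.parts.toFinset ⊆ insert 1 m.toFinset := by
      intro k hk
      rw [Multiset.mem_toFinset, hdec, Multiset.mem_add] at hk
      rcases hk with hk | hk
      · exact Finset.mem_insert_of_mem (Multiset.mem_toFinset.2 hk)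
      · rw [Multiset.eq_of_mem_replicate hk]; exact Finset.mem_insert_self _ _
    have h1 : 1 ∉ m.toFinset := by simp [hm]
    rw [centralizerOrder_eq hs, Finset.prod_insert h1, ← ha]
    have hprod : l.parts.prod = m.prod := by
      rw [hdec, Multiset.prod_add, Multiset.prod_replicate, one_pow, mul_one]
    have hna : n - m.sum = a := by omega
    rw [hprod, hna, Finset.prod_congr rfl fun k hk => by
      rw [hdec, Multiset.count_add, Multiset.count_replicate,
        if_neg (by rintro rfl; exact h1 hk), add_zero]]
    ring

theorem sum_perm_cycleSizes {A : Type*} [AddCommGroup A] [Module ℚ A] (n : ℕ)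
    (f : Multiset ℕ → A) :
    ∑ σ : Equiv.Perm (Fin n), f (cycleSizes σ) =
      (n.factorial : ℚ) • ∑ l : n.Partition, ((centralizerOrder l.parts : ℚ)⁻¹) • f l.parts := by
  classical
  let p (σ : Equiv.Perm (Fin n)) : n.Partition :=
    ⟨cycleSizes σ, by
      rw [cycleSizes_eq_parts]; exact σ.partition.parts_pos, by
      rw [sum_cycleSizes, Fintype.card_fin]⟩
  rw [← Finset.sum_fiberwise Finset.univ p, Finset.smul_sum]
  refine Finset.sum_congr rfl fun l _ => ?_
  have h1 : ∀ σ, p σ = l ↔ cycleSizes σ = l.parts := fun σ => by rw [Nat.Partition.ext_iff]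
  rw [Finset.sum_congr rfl fun σ hσ => by rw [(h1 σ).1 (Finset.mem_filter.1 hσ).2],
    Finset.sum_const, ← Nat.cast_smul_eq_nsmul ℚ, smul_smul]
  congr 1
  rw [← card_cycleSizes_eq n l, Nat.cast_mul, mul_assoc, mul_inv_cancel₀, mul_one]
  · simp_rw [h1]
  · exact_mod_cast (centralizerOrder_pos fun k hk => l.parts_pos hk).ne'

/-- `∑ z_λ⁻¹ f(λ)` over the partitions `λ` of `n`: the mean over `S_n` of the class function with
value `f(λ)` at permutations of cycle type `λ`. -/
def partitionMean {A : Type*} [AddCommGroup A] [Module ℚ A] (n : ℕ) (f : Multiset ℕ → A) : A :=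
  ∑ l : n.Partition, ((centralizerOrder l.parts : ℚ)⁻¹) • f l.parts

/-- Adjoining a part `k` maps the partitions of `n - k` bijectively onto those partitions of `n`
that contain `k`, and by `centralizerOrder_cons` the weight c_k(λ)/z_λ becomes 1/(k z_μ) for λ = μ ∪
{k}. Partitions without `k` have weight zero. -/
theorem partitionMean_count {A : Type*} [AddCommGroup A] [Module ℚ A] {n k : ℕ} (hk : 0 < k)
    (hkn : k ≤ n) (f : Multiset ℕ → A) :
    partitionMean n (fun m => (m.count k : ℚ) • f m) =
      ((k : ℚ)⁻¹) • partitionMean (n - k) (fun m => f (k ::ₘ m)) := by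
  classical
  rw [partitionMean, partitionMean, Finset.smul_sum]
  symm
  refine Finset.sum_of_injOn (fun l : (n - k).Partition => (⟨k ::ₘ l.parts, ?_, ?_⟩ : n.Partition))
    ?_ ?_ ?_ ?_
  · intro i hi
    rcases Multiset.mem_cons.1 hi with rfl | hi
    exacts [hk, l.parts_pos hi]
  · rw [Multiset.sum_cons, l.parts_sum]; omega
  · intro l _ l' _ h
    rw [Nat.Partition.ext_iff] at h ⊢
    exact (Multiset.cons_inj_right _).1 h
  · intro l _; simp
  · intro l _ hl
    have : k ∉ l.parts := fun hmem => hl ⟨⟨l.parts.erase k,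
      fun hi => l.parts_pos (Multiset.mem_of_mem_erase hi), by
        have := l.parts_sum
        rw [← Multiset.cons_erase hmem, Multiset.sum_cons] at this
        omega⟩, by simp, by
        rw [Nat.Partition.ext_iff]; exact Multiset.cons_erase hmem⟩
    rw [Multiset.count_eq_zero_of_notMem this, Nat.cast_zero, zero_smul, smul_zero]
  · intro l _
    dsimp only
    rw [centralizerOrder_cons, Multiset.count_cons_self, smul_smul, smul_smul]
    congr 1
    have h1 : (centralizerOrder l.parts : ℚ) ≠ 0 := by
      exact_mod_cast (centralizerOrder_pos fun k hk => l.parts_pos hk).ne'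
    have h2 : (k : ℚ) ≠ 0 := by exact_mod_cast hk.ne'
    push_cast
    have h3 : ((l.parts.count k : ℚ) + 1) ≠ 0 := by positivity
    field_simp

theorem partitionMean_add {A : Type*} [AddCommGroup A] [Module ℚ A] (n : ℕ)
    (f g : Multiset ℕ → A) :
    partitionMean n (fun m => f m + g m) = partitionMean n f + partitionMean n g := by
  simp [partitionMean, Finset.sum_add_distrib]

theorem partitionMean_smul {A : Type*} [AddCommGroup A] [Module ℚ A] (n : ℕ) (a : ℚ)
    (f : Multiset ℕ → A) :
    partitionMean n (fun m => a • f m) = a • partitionMean n f := by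
  simp [partitionMean, Finset.smul_sum, smul_comm a]

theorem partitionMean_mul_left {A : Type*} [CommRing A] [Algebra ℚ A] (n : ℕ) (a : A)
    (f : Multiset ℕ → A) :
    partitionMean n (fun m => a * f m) = a * partitionMean n f := by
  simp [partitionMean, Finset.mul_sum]

/-- This is Newton's identity n h_n = ∑ p_k h_{n-k} at the variables 1, t, t², …, where p_k = (1 -
t^k)⁻¹ and h_m = ∏_{i≤m} (1 - t^i)⁻¹. The proof rests on t^m h_m = h_m - h_{m-1}, which telescopes.
-/
theorem sum_mul_eq_smul_prod {A : Type*} [CommRing A] {t : A} {y : ℕ → A}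
    (hy : ∀ k, 0 < k → y k * (1 - t ^ k) = 1) (n : ℕ) :
    ∑ j ∈ Finset.range n, y (j + 1) * ∏ i ∈ Finset.range (n - 1 - j), y (i + 1) =
      (n : A) * ∏ i ∈ Finset.range n, y (i + 1) := by
  set h : ℕ → A := fun m => ∏ i ∈ Finset.range m, y (i + 1) with hh
  change ∑ j ∈ Finset.range n, y (j + 1) * h (n - 1 - j) = n * h n
  have hd (m : ℕ) : t ^ (m + 1) * h (m + 1) = h (m + 1) - h m := by
    have : h (m + 1) = h m * y (m + 1) := Finset.prod_range_succ _ _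
    rw [this]
    linear_combination (- h m) * hy (m + 1) (Nat.succ_pos m)
  have hd0 : h 0 = 1 := Finset.prod_range_zero _
  have htel (n : ℕ) : ∑ j ∈ Finset.range (n + 1), t ^ (n - j) * h (n - j) = h n := by
    rw [← Finset.sum_range_reflect]
    rw [Finset.sum_congr rfl fun j hj => by
      rw [show n - (n + 1 - 1 - j) = j by have := Finset.mem_range.1 hj; omega]]
    induction n with
    | zero => simp
    | succ n ih => rw [Finset.sum_range_succ, ih, hd]; ring
  induction n with
  | zero => simp
  | succ n ih =>
    set S := ∑ j ∈ Finset.range (n + 1), y (j + 1) * h (n + 1 - 1 - j) with hS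
    have h1 : ∑ j ∈ Finset.range (n + 1), y (j + 1) * (t ^ (n - j) * h (n - j)) =
        S - ∑ j ∈ Finset.range n, y (j + 1) * h (n - 1 - j) := by
      rw [hS, Finset.sum_range_succ, Finset.sum_range_succ, add_sub_right_comm,
        ← Finset.sum_sub_distrib]
      congr 1
      · refine Finset.sum_congr rfl fun j hj => ?_
        obtain ⟨m, rfl⟩ := Nat.exists_eq_add_of_lt (Finset.mem_range.1 hj)
        rw [show j + m + 1 - j = m + 1 by omega, show j + m + 1 + 1 - 1 - j = m + 1 by omega,
          show j + m + 1 - 1 - j = m by omega, hd]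
        ring
      · simp [hd0]
    -- Write t^{n+1} = t^{j+1} t^{n-j} and use y(j+1) t^{j+1} = y(j+1) - 1. The result says (1 -
    -- t^{n+1}) S = (n + 1) h_n.
    have h2 : t ^ (n + 1) * S = S - (n : A) * h n - h n := by
      rw [← ih, ← h1, ← htel n, ← Finset.sum_sub_distrib, hS, Finset.mul_sum]
      refine Finset.sum_congr rfl fun j hj => ?_
      have hj' := Finset.mem_range.1 hj
      rw [show n + 1 - 1 - j = n - j by omega, show n + 1 = (j + 1) + (n - j) by omega, pow_add]
      linear_combination (-(t ^ (n - j) * h (n - j))) * hy (j + 1) (Nat.succ_pos j)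
    have h3 : h (n + 1) = h n * y (n + 1) := Finset.prod_range_succ _ _
    rw [h3]
    push_cast
    linear_combination (-y (n + 1)) * h2 + (-S) * hy (n + 1) (Nat.succ_pos n)

theorem sum_mul_count (n : ℕ) (l : n.Partition) :
    ∑ k ∈ Finset.range n, (k + 1) * l.parts.count (k + 1) = n := by
  classical
  have hs : l.parts.toFinset ⊆ Finset.range (n + 1) := fun k hk => by
    have := Multiset.le_sum_of_mem (Multiset.mem_toFinset.1 hk)
    rw [l.parts_sum] at this
    exact Finset.mem_range.2 (by omega)
  have h := Finset.sum_multiset_count_of_subset l.parts _ hs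
  rw [l.parts_sum, Finset.sum_range_succ'] at h
  simp only [smul_eq_mul, mul_zero, add_zero] at h
  conv_rhs => rw [h]
  exact Finset.sum_congr rfl fun k _ => mul_comm _ _

/-- The mean over `S_n` of `∏ (1 - t^d)⁻¹` over the cycle lengths `d` is `∏_{j ≤ n} (1 - t^j)⁻¹`. -/
theorem partitionMean_prod {A : Type*} [CommRing A] [Algebra ℚ A] {t : A} {y : ℕ → A}
    (hy : ∀ k, 0 < k → y k * (1 - t ^ k) = 1) (n : ℕ) :
    partitionMean n (fun m => (m.map y).prod) = ∏ i ∈ Finset.range n, y (i + 1) := by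
  induction n using Nat.strong_induction_on with
  | _ n ih =>
  rcases Nat.eq_zero_or_pos n with rfl | hn
  · have : Subsingleton (Nat.Partition 0) := inferInstance
    simp [partitionMean, centralizerOrder]
  have hn' : (n : ℚ) ≠ 0 := by exact_mod_cast hn.ne'
  have key : (n : ℚ) • partitionMean n (fun m => (m.map y).prod) =
      (n : ℚ) • ∏ i ∈ Finset.range n, y (i + 1) := by
    -- Insert n = ∑ k c_k(λ) under the mean. Each c_k then removes a k-cycle, leaving a mean over a
    -- smaller symmetric group.
    have h1 : (n : ℚ) • partitionMean n (fun m => (m.map y).prod) =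
        ∑ k ∈ Finset.range n, ((k + 1 : ℕ) : ℚ) •
          partitionMean n (fun m => (m.count (k + 1) : ℚ) • (m.map y).prod) := by
      simp_rw [partitionMean, Finset.smul_sum]
      rw [Finset.sum_comm]
      refine Finset.sum_congr rfl fun l _ => ?_
      simp_rw [smul_smul]
      rw [← Finset.sum_smul]
      congr 1
      have h0 : (n : ℚ) = ∑ k ∈ Finset.range n, (k + 1 : ℚ) * l.parts.count (k + 1) := by
        exact_mod_cast (sum_mul_count n l).symm
      rw [h0, Finset.sum_mul]
      push_cast
      refine Finset.sum_congr rfl fun k _ => by ring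
    have h2 (k : ℕ) (hk : k ∈ Finset.range n) : ((k + 1 : ℕ) : ℚ) •
          partitionMean n (fun m => (m.count (k + 1) : ℚ) • (m.map y).prod) =
        y (k + 1) * ∏ i ∈ Finset.range (n - 1 - k), y (i + 1) := by
      have hk' := Finset.mem_range.1 hk
      rw [partitionMean_count (Nat.succ_pos k) (by omega), smul_smul, mul_inv_cancel₀, one_smul]
      · simp_rw [Multiset.map_cons, Multiset.prod_cons]
        rw [partitionMean_mul_left, ih _ (by omega), show n - 1 - k = n - (k + 1) by omega]
      · exact_mod_cast Nat.succ_ne_zero k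
    rw [h1, Finset.sum_congr rfl h2, sum_mul_eq_smul_prod hy, Algebra.smul_def]
    simp
  have := congrArg (fun a => (n : ℚ)⁻¹ • a) key
  simpa [smul_smul, inv_mul_cancel₀ hn'] using this

end

noncomputable section

open Filter Topology

/-! ## Stable values of means of character polynomials -/

/-- The value of a character polynomial on a multiset of cycle lengths. -/
def CharacterPolynomial.evalCounts (P : CharacterPolynomial) (m : Multiset ℕ) : ℚ :=
  MvPolynomial.eval (fun k : ℕ+ => (m.count (k : ℕ) : ℚ)) P

theorem CharacterPolynomial.evalPerm_eq_evalCounts (P : CharacterPolynomial) {ι : Type*} [Finite ι]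
    (w : Equiv.Perm ι) : P.evalPerm w = P.evalCounts (cycleSizes w) := by
  simp only [evalPerm, evalCounts, cycleCount_eq_count]

/-- `∏_{j ≤ n} (1 - t^j)` times the mean over `S_n` of `P ∏ (1 - t^d)⁻¹`, where `y d = (1 - t^d)⁻¹`
and the cycle counts at which `P` is evaluated are shifted by those of `s`. -/
def twistedMean {A : Type*} [CommRing A] [Algebra ℚ A] (t : A) (y : ℕ → A)
    (P : CharacterPolynomial) (s : Multiset ℕ) (n : ℕ) : A :=
  (∏ i ∈ Finset.range n, (1 - t ^ (i + 1))) *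
    partitionMean n (fun m => P.evalCounts (s + m) • (m.map y).prod)

section twistedMean

variable {A : Type*} [CommRing A] [Algebra ℚ A] {t : A} {y : ℕ → A}

/-- By `partitionMean_prod` the normalizing product cancels the mean exactly, already at finite `n`.
-/
theorem twistedMean_C (hy : ∀ k, 0 < k → y k * (1 - t ^ k) = 1) (a : ℚ) (s : Multiset ℕ) (n : ℕ) :
    twistedMean t y (MvPolynomial.C a) s n = algebraMap ℚ A a := by
  simp only [twistedMean, CharacterPolynomial.evalCounts, MvPolynomial.eval_C]
  rw [partitionMean_smul, partitionMean_prod hy, mul_smul_comm, ← Finset.prod_mul_distrib,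
    Finset.prod_congr rfl fun i _ => (mul_comm _ _).trans (hy (i + 1) i.succ_pos),
    Finset.prod_const_one, Algebra.algebraMap_eq_smul_one]

theorem twistedMean_add (P Q : CharacterPolynomial) (s : Multiset ℕ) (n : ℕ) :
    twistedMean t y (P + Q) s n = twistedMean t y P s n + twistedMean t y Q s n := by
  simp only [twistedMean, CharacterPolynomial.evalCounts, map_add, add_smul]
  rw [partitionMean_add, mul_add]

/-- The count of `k` in `s + m` is a sum of two: the part from `s` is a scalar, and the part from
`m` removes a k-cycle by `partitionMean_count`. The removed cycle leaves `y k` behind and enters the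
shift, since `P` must still see it. The normalizing product loses its last `k` factors, which tend
to 1. -/
theorem twistedMean_mul_X (P : CharacterPolynomial) (k : ℕ+) (s : Multiset ℕ) (n : ℕ) :
    twistedMean t y (P * MvPolynomial.X k) s (n + k) =
      (s.count (k : ℕ) : ℚ) • twistedMean t y P s (n + k) +
      ((k : ℕ) : ℚ)⁻¹ • (y k * ((∏ i ∈ Finset.range k, (1 - t ^ (n + i + 1))) *
        twistedMean t y P ((k : ℕ) ::ₘ s) n)) := by
  have h1 : partitionMean (n + k) (fun m => CharacterPolynomial.evalCounts
        (P * MvPolynomial.X k) (s + m) • (m.map y).prod) =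
      (s.count (k : ℕ) : ℚ) • partitionMean (n + k) (fun m => P.evalCounts (s + m) •
        (m.map y).prod) +
      ((k : ℕ) : ℚ)⁻¹ • (y k * partitionMean n (fun m =>
        P.evalCounts (((k : ℕ) ::ₘ s) + m) • (m.map y).prod)) := by
    have h2 (m : Multiset ℕ) : CharacterPolynomial.evalCounts
        (P * MvPolynomial.X k) (s + m) • (m.map y).prod =
        (s.count (k : ℕ) : ℚ) • (P.evalCounts (s + m) • (m.map y).prod) +
        (m.count (k : ℕ) : ℚ) • (P.evalCounts (s + m) • (m.map y).prod) := by
      rw [← add_smul, smul_smul]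
      congr 1
      simp only [CharacterPolynomial.evalCounts, map_mul, MvPolynomial.eval_X,
        Multiset.count_add]
      push_cast
      ring
    simp_rw [h2]
    rw [partitionMean_add, partitionMean_smul, partitionMean_count k.pos (Nat.le_add_left _ _),
      Nat.add_sub_cancel, ← partitionMean_mul_left]
    simp only [Multiset.map_cons, Multiset.prod_cons, Multiset.add_cons, Multiset.cons_add,
      mul_smul_comm]
  rw [twistedMean, h1, mul_add, mul_smul_comm, mul_smul_comm, twistedMean, twistedMean,
    Finset.prod_range_add]
  congr 2
  ring

end twistedMean

/-! ### Coefficientwise limits and values of power series -/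

/-- A sequence of power series converges to `C` coefficientwise, each coefficient being eventually
constant. -/
def StabilizesTo (g : ℕ → PowerSeries ℚ) (C : PowerSeries ℚ) : Prop :=
  ∀ i, Tendsto (fun n => PowerSeries.coeff i (g n)) atTop (pure (PowerSeries.coeff i C))

namespace StabilizesTo

variable {g h : ℕ → PowerSeries ℚ} {C D : PowerSeries ℚ}

theorem const (C : PowerSeries ℚ) : StabilizesTo (fun _ => C) C := fun _ =>
  tendsto_const_pure

theorem of_add_right (k : ℕ) (hg : StabilizesTo (fun n => g (n + k)) C) : StabilizesTo g C :=
  fun i => (tendsto_add_atTop_iff_nat k).1 (hg i)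

theorem comp_add_right (k : ℕ) (hg : StabilizesTo g C) : StabilizesTo (fun n => g (n + k)) C :=
  fun i => (tendsto_add_atTop_iff_nat k).2 (hg i)

theorem add (hg : StabilizesTo g C) (hh : StabilizesTo h D) :
    StabilizesTo (fun n => g n + h n) (C + D) := fun i => by
  rw [tendsto_pure]
  filter_upwards [tendsto_pure.1 (hg i), tendsto_pure.1 (hh i)] with n h1 h2
  rw [map_add, map_add, h1, h2]

/-- A coefficient of a product involves only finitely many coefficients of the factors, so they are
all stable from some point on. -/
theorem mul (hg : StabilizesTo g C) (hh : StabilizesTo h D) :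
    StabilizesTo (fun n => g n * h n) (C * D) := fun i => by
  rw [tendsto_pure]
  have : ∀ᶠ n in atTop, ∀ p ∈ Finset.HasAntidiagonal.antidiagonal i,
      PowerSeries.coeff p.1 (g n) = PowerSeries.coeff p.1 C ∧
      PowerSeries.coeff p.2 (h n) = PowerSeries.coeff p.2 D :=
    (eventually_all_finset _).2 fun p _ =>
      (tendsto_pure.1 (hg p.1)).and (tendsto_pure.1 (hh p.2))
  filter_upwards [this] with n hn
  rw [PowerSeries.coeff_mul, PowerSeries.coeff_mul]
  exact Finset.sum_congr rfl fun p hp => by rw [(hn p hp).1, (hn p hp).2]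

theorem smul (a : ℚ) (hg : StabilizesTo g C) : StabilizesTo (fun n => a • g n) (a • C) := by
  simp only [PowerSeries.smul_eq_C_mul]
  exact (const _).mul hg

theorem finset_prod {ι : Type*} (s : Finset ι) {g : ι → ℕ → PowerSeries ℚ}
    (hg : ∀ j ∈ s, StabilizesTo (g j) 1) : StabilizesTo (fun n => ∏ j ∈ s, g j n) 1 := by
  classical
  induction s using Finset.induction_on with
  | empty => simpa using const 1
  | insert a s ha ih =>
    simp only [Finset.prod_insert ha]
    simpa using (hg a (Finset.mem_insert_self _ _)).mul
      (ih fun j hj => hg j (Finset.mem_insert_of_mem hj))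

theorem one_sub_X_pow (c : ℕ) :
    StabilizesTo (fun n => 1 - (PowerSeries.X : PowerSeries ℚ) ^ (n + c + 1)) 1 := fun i => by
  rw [tendsto_pure]
  filter_upwards [eventually_ge_atTop i] with n hn
  rw [map_sub, PowerSeries.coeff_X_pow, if_neg (by omega), sub_zero]

end StabilizesTo

/-- The power series `C` converges absolutely at `x`, with value `v`. -/
def HasValueAt (C : PowerSeries ℚ) (x v : ℝ) : Prop :=
  Summable (fun i => ‖((PowerSeries.coeff i C : ℚ) : ℝ) * x ^ i‖) ∧
    HasSum (fun i => ((PowerSeries.coeff i C : ℚ) : ℝ) * x ^ i) v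

namespace HasValueAt

variable {C D : PowerSeries ℚ} {x v v' : ℝ}

theorem add (hC : HasValueAt C x v) (hD : HasValueAt D x v') : HasValueAt (C + D) x (v + v') := by
  have h : ∀ i, ((PowerSeries.coeff i (C + D) : ℚ) : ℝ) * x ^ i =
      ((PowerSeries.coeff i C : ℚ) : ℝ) * x ^ i + ((PowerSeries.coeff i D : ℚ) : ℝ) * x ^ i := fun i => by
    rw [map_add]; push_cast; ring
  simp only [HasValueAt, h]
  exact ⟨(hC.1.add hD.1).of_nonneg_of_le (fun _ => norm_nonneg _) (fun _ => norm_add_le _ _),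
    hC.2.add hD.2⟩

theorem smul (a : ℚ) (hC : HasValueAt C x v) : HasValueAt (a • C) x (a • v) := by
  have h : ∀ i, ((PowerSeries.coeff i (a • C) : ℚ) : ℝ) * x ^ i =
      (a : ℝ) * (((PowerSeries.coeff i C : ℚ) : ℝ) * x ^ i) := fun i => by
    rw [PowerSeries.coeff_smul, smul_eq_mul]; push_cast; ring
  simp only [HasValueAt, h, norm_mul (a : ℝ)]
  rw [Rat.smul_def]
  exact ⟨hC.1.mul_left _, hC.2.mul_left _⟩

/-- The Cauchy product; this is where absolute convergence, rather than convergence, is used. -/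
theorem mul (hC : HasValueAt C x v) (hD : HasValueAt D x v') : HasValueAt (C * D) x (v * v') := by
  have h : ∀ i, ((PowerSeries.coeff i (C * D) : ℚ) : ℝ) * x ^ i = ∑ p ∈ Finset.HasAntidiagonal.antidiagonal i,
      (((PowerSeries.coeff p.1 C : ℚ) : ℝ) * x ^ p.1) * (((PowerSeries.coeff p.2 D : ℚ) : ℝ) * x ^ p.2) :=
    fun i => by
    rw [PowerSeries.coeff_mul]
    push_cast
    rw [Finset.sum_mul]
    refine Finset.sum_congr rfl fun p hp => ?_
    rw [← Finset.HasAntidiagonal.mem_antidiagonal.1 hp, pow_add]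
    ring
  simp only [HasValueAt, h]
  have hs := summable_norm_sum_mul_antidiagonal_of_summable_norm hC.1 hD.1
  refine ⟨hs, ?_⟩
  rw [← hC.2.tsum_eq, ← hD.2.tsum_eq,
    tsum_mul_tsum_eq_tsum_sum_antidiagonal_of_summable_norm hC.1 hD.1]
  exact hs.of_norm.hasSum

theorem const (a : ℚ) : HasValueAt (PowerSeries.C a) x a := by
  have h : ∀ i, i ≠ 0 → ((PowerSeries.coeff i (PowerSeries.C a) : ℚ) : ℝ) * x ^ i = 0 := fun i hi => by
    rw [PowerSeries.coeff_C, if_neg hi]; simp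
  constructor
  · exact summable_of_ne_finset_zero (s := {0}) fun i hi => by
      rw [h i (by simpa using hi), norm_zero]
  · convert hasSum_single 0 h using 1
    simp

end HasValueAt

theorem PowerSeries.coeff_inv_one_sub_X_pow {k : ℕ} (hk : 0 < k) (i : ℕ) :
    PowerSeries.coeff i ((1 - PowerSeries.X ^ k : PowerSeries ℚ)⁻¹) = if k ∣ i then 1 else 0 := by
  have h0 : PowerSeries.constantCoeff (1 - PowerSeries.X ^ k : PowerSeries ℚ) ≠ 0 := by
    simp [hk.ne']
  have : (PowerSeries.mk fun i => if k ∣ i then (1 : ℚ) else 0) =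
      (1 - PowerSeries.X ^ k : PowerSeries ℚ)⁻¹ := by
    rw [PowerSeries.eq_inv_iff_mul_eq_one h0, mul_sub, mul_one]
    ext i
    rw [map_sub, PowerSeries.coeff_mul_X_pow', PowerSeries.coeff_mk, PowerSeries.coeff_one]
    rcases lt_or_ge i k with hi | hi
    · rw [if_neg (not_le.2 hi), sub_zero]
      rcases Nat.eq_zero_or_pos i with rfl | hi0
      · simp
      · rw [if_neg (fun h => by have := Nat.le_of_dvd hi0 h; omega), if_neg hi0.ne']
    · rw [if_pos hi, PowerSeries.coeff_mk, if_neg (show i ≠ 0 by omega)]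
      have hd : k ∣ i - k ↔ k ∣ i := by rw [Nat.dvd_sub_iff_left hi dvd_rfl]
      simp only [hd, sub_self]
  rw [← this, PowerSeries.coeff_mk]

theorem HasValueAt.inv_one_sub_X_pow {k : ℕ} (hk : 0 < k) {x : ℝ} (hx0 : 0 ≤ x) (hx : x < 1) :
    HasValueAt ((1 - PowerSeries.X ^ k : PowerSeries ℚ)⁻¹) x ((1 - x ^ k)⁻¹) := by
  have hinj : Function.Injective fun m : ℕ => k * m := fun a b h =>
    Nat.eq_of_mul_eq_mul_left hk h
  have hgeo : HasSum (fun m : ℕ => (x ^ k) ^ m) ((1 - x ^ k)⁻¹) :=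
    hasSum_geometric_of_lt_one (by positivity) (pow_lt_one₀ hx0 hx hk.ne')
  have hsum : HasSum (fun i => ((PowerSeries.coeff i ((1 - PowerSeries.X ^ k : PowerSeries ℚ)⁻¹) : ℚ) : ℝ)
      * x ^ i) ((1 - x ^ k)⁻¹) := by
    rw [← hinj.hasSum_iff]
    · convert hgeo using 2 with m
      simp only [Function.comp_apply]
      rw [PowerSeries.coeff_inv_one_sub_X_pow hk, if_pos (dvd_mul_right _ _), pow_mul]
      simp
    · intro i hi
      rw [PowerSeries.coeff_inv_one_sub_X_pow hk, if_neg]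
      · simp
      · rintro ⟨m, rfl⟩
        exact hi ⟨m, rfl⟩
  refine ⟨?_, hsum⟩
  convert hsum.summable using 2 with i
  rw [PowerSeries.coeff_inv_one_sub_X_pow hk]
  rw [Real.norm_of_nonneg]
  split_ifs
  · simp; positivity
  · simp

theorem inv_one_sub_X_pow_mul {k : ℕ} (hk : 0 < k) :
    (1 - PowerSeries.X ^ k : PowerSeries ℚ)⁻¹ * (1 - PowerSeries.X ^ k) = 1 :=
  PowerSeries.inv_mul_cancel _ (by simp [hk.ne'])

/-- The twisted means of a character polynomial stabilize as power series, and their values at a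
real number in `[0, 1)` converge to the value of the stable power series. -/
theorem exists_stable_twistedMean (P : CharacterPolynomial) {x : ℝ} (hx0 : 0 ≤ x) (hx : x < 1)
    (s : Multiset ℕ) :
    ∃ (C : PowerSeries ℚ) (v : ℝ),
      StabilizesTo (twistedMean PowerSeries.X (fun k => (1 - PowerSeries.X ^ k)⁻¹) P s) C ∧
      HasValueAt C x v ∧
      Tendsto (twistedMean x (fun k => (1 - x ^ k)⁻¹) P s) atTop (𝓝 v) := by
  -- The shift has to vary: the case `P * X k` uses the hypothesis at `s` and at `k ::ₘ s`.
  induction P using MvPolynomial.induction_on generalizing s with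
  | C a =>
    refine ⟨PowerSeries.C a, a, ?_, HasValueAt.const a, ?_⟩
    · have : twistedMean PowerSeries.X (fun k => (1 - PowerSeries.X ^ k)⁻¹)
          (MvPolynomial.C a) s = fun _ => PowerSeries.C a := by
        funext n
        rw [twistedMean_C fun k hk => inv_one_sub_X_pow_mul hk]
        rfl
      rw [this]
      exact StabilizesTo.const _
    · have : twistedMean x (fun k => (1 - x ^ k)⁻¹) (MvPolynomial.C a) s = fun _ => (a : ℝ) := by
        funext n
        rw [twistedMean_C fun k hk => ?_]
        · rfl
        · exact inv_mul_cancel₀ (sub_pos.2 (pow_lt_one₀ hx0 hx hk.ne')).ne'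
      rw [this]
      exact tendsto_const_nhds
  | add P Q ihP ihQ =>
    obtain ⟨C, v, h1, h2, h3⟩ := ihP s
    obtain ⟨D, u, k1, k2, k3⟩ := ihQ s
    refine ⟨C + D, v + u, ?_, h2.add k2, ?_⟩
    · have := h1.add k1
      simpa only [← twistedMean_add] using this
    · have := h3.add k3
      simpa only [← twistedMean_add] using this
  | mul_X P k ih =>
    obtain ⟨C, v, h1, h2, h3⟩ := ih s
    obtain ⟨D, u, k1, k2, k3⟩ := ih ((k : ℕ) ::ₘ s)
    -- The right side of `twistedMean_mul_X` in the limit; the explicit `1` is the limit of the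
    -- product of the factors 1 - t^{n+i+1}.
    refine ⟨(s.count (k : ℕ) : ℚ) • C + ((k : ℕ) : ℚ)⁻¹ • ((1 - PowerSeries.X ^ (k : ℕ))⁻¹ * (1 * D)),
      (s.count (k : ℕ) : ℚ) • v + ((k : ℕ) : ℚ)⁻¹ • ((1 - x ^ (k : ℕ))⁻¹ * (1 * u)), ?_, ?_, ?_⟩
    · refine StabilizesTo.of_add_right k ?_
      simp only [twistedMean_mul_X]
      refine ((h1.comp_add_right k).smul _).add (StabilizesTo.smul _ ((StabilizesTo.const _).mul
        (StabilizesTo.mul ?_ k1)))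
      exact StabilizesTo.finset_prod _ fun j _ => StabilizesTo.one_sub_X_pow j
    · rw [one_mul, one_mul]
      exact (h2.smul _).add (((HasValueAt.inv_one_sub_X_pow k.pos hx0 hx).mul k2).smul _)
    · rw [← tendsto_add_atTop_iff_nat (k : ℕ)]
      simp only [twistedMean_mul_X]
      refine (((tendsto_add_atTop_iff_nat (k : ℕ)).2 h3).const_smul _).add
        (((tendsto_const_nhds).mul (Tendsto.mul ?_ k3)).const_smul _)
      have : ∀ j ∈ Finset.range (k : ℕ), Tendsto (fun n : ℕ => 1 - x ^ (n + j + 1)) atTop (𝓝 1) :=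
        fun j _ => by
          have := (tendsto_pow_atTop_nhds_zero_of_lt_one hx0 hx).comp (tendsto_add_atTop_nat (j + 1))
          simpa [Function.comp_def, add_assoc] using this.const_sub 1
      simpa using tendsto_finsetProd _ this

end

noncomputable section

/-! ## The elementary symmetric polynomials form a regular sequence -/

/-- The sequence `l` is weakly regular modulo `J`: each term is a nonzerodivisor modulo `J` and the
preceding terms. -/
def IsWeaklyRegularMod {A : Type*} [CommRing A] : Ideal A → List A → Prop
  | _, [] => True
  | J, s :: l => (∀ a, s * a ∈ J → a ∈ J) ∧ IsWeaklyRegularMod (J ⊔ Ideal.span {s}) l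

namespace IsWeaklyRegularMod

variable {A B : Type*} [CommRing A] [CommRing B]

theorem mem_sup_span {J : Ideal A} {s a : A} :
    a ∈ J ⊔ Ideal.span {s} ↔ ∃ b, a - s * b ∈ J := by
  rw [Submodule.mem_sup]
  constructor
  · rintro ⟨j, hj, z, hz, rfl⟩
    obtain ⟨b, rfl⟩ := Ideal.mem_span_singleton.1 hz
    exact ⟨b, by simpa using hj⟩
  · rintro ⟨b, hb⟩
    exact ⟨_, hb, s * b, Ideal.mul_mem_right _ _ (Ideal.mem_span_singleton_self s), by ring⟩

theorem top (l : List A) : IsWeaklyRegularMod (⊤ : Ideal A) l := by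
  induction l with
  | nil => trivial
  | cons s l ih => exact ⟨fun _ _ => trivial, by rwa [top_sup_eq]⟩

/-- With `x` a nonzerodivisor modulo `J`, multiplication by `x` gives 0 → A/(J, y) → A/(J, xy) →
A/(J, x) → 0, and a nonzerodivisor on both ends is one in the middle. To continue along the list,
`x` must remain a nonzerodivisor modulo `(J, s)`; this follows from `s` being one modulo `(J, x)`.
-/
theorem mul {J : Ideal A} {l : List A} {x y : A} (hx : ∀ a, x * a ∈ J → a ∈ J)
    (h1 : IsWeaklyRegularMod (J ⊔ Ideal.span {x}) l)
    (h2 : IsWeaklyRegularMod (J ⊔ Ideal.span {y}) l) :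
    IsWeaklyRegularMod (J ⊔ Ideal.span {x * y}) l := by
  induction l generalizing J with
  | nil => trivial
  | cons s l ih =>
    refine ⟨fun a ha => ?_, ?_⟩
    · obtain ⟨b, hb⟩ := mem_sup_span.1 ha
      obtain ⟨a', ha'⟩ := mem_sup_span.1 (h1.1 a (mem_sup_span.2 ⟨y * b, by rwa [← mul_assoc]⟩))
      have h3 : s * a' - y * b ∈ J := by
        refine hx _ ?_
        have : x * (s * a' - y * b) = (s * a - x * y * b) - s * (a - x * a') := by ring
        rw [this]
        exact J.sub_mem hb (J.mul_mem_left _ ha')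
      obtain ⟨c, hc⟩ := mem_sup_span.1 (h2.1 a' (mem_sup_span.2 ⟨b, h3⟩))
      refine mem_sup_span.2 ⟨c, ?_⟩
      have : a - x * y * c = (a - x * a') + x * (a' - y * c) := by ring
      rw [this]
      exact J.add_mem ha' (J.mul_mem_left _ hc)
    · rw [sup_right_comm]
      refine ih (fun a ha => ?_) ?_ ?_
      · obtain ⟨b, hb⟩ := mem_sup_span.1 ha
        have h3 : s * b ∈ J ⊔ Ideal.span {x} := mem_sup_span.2 ⟨a, by
          have : s * b - x * a = -(x * a - s * b) := by ring
          rw [this]; exact J.neg_mem hb⟩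
        obtain ⟨b', hb'⟩ := mem_sup_span.1 (h1.1 b h3)
        refine mem_sup_span.2 ⟨b', hx _ ?_⟩
        have : x * (a - s * b') = (x * a - s * b) + s * (b - x * b') := by ring
        rw [this]
        exact J.add_mem hb (J.mul_mem_left _ hb')
      · rw [sup_right_comm]; exact h1.2
      · rw [sup_right_comm]; exact h2.2

/-- The quotients by `J.comap φ` and by `J` are isomorphic, and adding a generator to either ideal
preserves this. -/
theorem of_surjective {φ : A →+* B} (hφ : Function.Surjective φ) {J : Ideal B} {l : List A}
    (h : IsWeaklyRegularMod J (l.map φ)) : IsWeaklyRegularMod (J.comap φ) l := by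
  induction l generalizing J with
  | nil => trivial
  | cons s l ih =>
    refine ⟨fun a ha => h.1 _ (by simpa using ha), ?_⟩
    have : J.comap φ ⊔ Ideal.span {s} = (J ⊔ Ideal.span {φ s}).comap φ := by
      ext a
      rw [mem_sup_span, Ideal.mem_comap, mem_sup_span]
      constructor
      · rintro ⟨b, hb⟩
        exact ⟨φ b, by simpa using hb⟩
      · rintro ⟨b, hb⟩
        obtain ⟨b, rfl⟩ := hφ b
        exact ⟨b, by simpa using hb⟩
    rw [this]
    exact ih h.2

theorem prod {ι : Type*} {l : List A} [IsDomain A] (s : Finset ι) (x : ι → A)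
    (hx : ∀ i ∈ s, x i ≠ 0) (h : ∀ i ∈ s, IsWeaklyRegularMod (Ideal.span {x i}) l) :
    IsWeaklyRegularMod (Ideal.span {∏ i ∈ s, x i}) l := by
  classical
  induction s using Finset.induction_on with
  | empty => rw [Finset.prod_empty, Ideal.span_singleton_one]; exact top l
  | insert a s ha ih =>
    rw [Finset.prod_insert ha, ← bot_sup_eq (Ideal.span _)]
    refine mul (fun b hb => ?_) ?_ ?_
    · exact (mul_eq_zero.1 hb).resolve_left (hx a (Finset.mem_insert_self _ _))
    · rw [bot_sup_eq]; exact h a (Finset.mem_insert_self _ _)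
    · rw [bot_sup_eq]
      exact ih (fun i hi => hx i (Finset.mem_insert_of_mem hi))
        fun i hi => h i (Finset.mem_insert_of_mem hi)

end IsWeaklyRegularMod

/-! ### Setting a variable to zero -/

open MvPolynomial in
/-- Setting the variable `x_i` to zero. -/
def killVariable {n : ℕ} (i : Fin (n + 1)) :
    MvPolynomial (Fin (n + 1)) ℚ →ₐ[ℚ] MvPolynomial (Fin n) ℚ :=
  aeval (i.insertNth (α := fun _ => MvPolynomial (Fin n) ℚ) 0 X)

section killVariable

open MvPolynomial

variable {n : ℕ} (i : Fin (n + 1))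

theorem killVariable_rename (f : MvPolynomial (Fin n) ℚ) :
    killVariable i (rename i.succAbove f) = f := by
  rw [killVariable, aeval_rename]
  have : (i.insertNth (α := fun _ => MvPolynomial (Fin n) ℚ) 0 X) ∘ i.succAbove = X := by
    funext j; simp
  rw [this, aeval_X_left_apply]

theorem killVariable_surjective : Function.Surjective (killVariable i) := fun f =>
  ⟨_, killVariable_rename i f⟩

theorem comap_killVariable :
    (⊥ : Ideal (MvPolynomial (Fin n) ℚ)).comap (killVariable i : MvPolynomial (Fin (n + 1)) ℚ →+* MvPolynomial (Fin n) ℚ) = Ideal.span {X i} := by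
  refine le_antisymm (fun f hf => ?_) ?_
  -- Reduction modulo `X i` factors through `killVariable i`, as one checks on the variables; so the
  -- kernel of the latter lies in the ideal.
  · have key : (Ideal.Quotient.mkₐ ℚ (Ideal.span {X i})) =
        ((Ideal.Quotient.mkₐ ℚ (Ideal.span {X i})).comp (rename i.succAbove)).comp
          (killVariable i) := by
      ext j
      refine Fin.succAboveCases i ?_ (fun j => ?_) j
      · simp only [AlgHom.comp_apply, killVariable, aeval_X, Fin.insertNth_apply_same, map_zero]
        exact Ideal.Quotient.eq_zero_iff_mem.2 (Ideal.mem_span_singleton_self _)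
      · simp [killVariable]
    have h0 : killVariable i f = 0 := hf
    have := DFunLike.congr_fun key f
    rw [AlgHom.comp_apply, h0, map_zero] at this
    exact Ideal.Quotient.eq_zero_iff_mem.1 this
  · rw [Ideal.span_le, Set.singleton_subset_iff]
    change killVariable i (X i) = 0
    simp [killVariable]

theorem killVariable_esymm (k : ℕ) :
    killVariable i (esymm (Fin (n + 1)) ℚ k) = esymm (Fin n) ℚ k := by
  have h : Multiset.map (i.insertNth (α := fun _ => MvPolynomial (Fin n) ℚ) 0 X)
      Finset.univ.val = 0 ::ₘ Multiset.map X Finset.univ.val := by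
    rw [Fin.univ_succAbove n i, Finset.cons_val, Multiset.map_cons, Finset.map_val,
      Multiset.map_map, Fin.insertNth_apply_same]
    congr 2
    funext j
    simp
  rw [killVariable, aeval_esymm_eq_multiset_esymm, h, esymm_eq_multiset_esymm]
  rcases k with _ | k
  · simp [Multiset.esymm]
  · rw [Multiset.esymm, Multiset.powersetCard_cons, Multiset.map_add, Multiset.sum_add,
      Multiset.map_map]
    simp [Multiset.esymm]

end killVariable

open MvPolynomial in
/-- The elementary symmetric polynomials `e_m, …, e_1`. -/
def esymmList (n : ℕ) : ℕ → List (MvPolynomial (Fin n) ℚ)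
  | 0 => []
  | m + 1 => esymm (Fin n) ℚ (m + 1) :: esymmList n m

theorem map_esymmList {n : ℕ} (i : Fin (n + 1)) (m : ℕ) :
    (esymmList (n + 1) m).map (killVariable i : MvPolynomial (Fin (n + 1)) ℚ →+* MvPolynomial (Fin n) ℚ) = esymmList n m := by
  induction m with
  | zero => rfl
  | succ m ih =>
    rw [esymmList, List.map_cons, ih, esymmList]
    congr 1
    exact killVariable_esymm i (m + 1)

theorem esymm_card (n : ℕ) :
    MvPolynomial.esymm (Fin n) ℚ n = ∏ i, MvPolynomial.X i := by
  have : Finset.powersetCard n (Finset.univ : Finset (Fin n)) = {Finset.univ} := by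
    have := Finset.powersetCard_self (Finset.univ : Finset (Fin n))
    rwa [Finset.card_fin] at this
  rw [MvPolynomial.esymm, this, Finset.sum_singleton]

/-- Induction on the number of variables. The head of the list is the product of all variables, so
by `IsWeaklyRegularMod.prod` it is enough to treat the tail modulo a single variable. There it
becomes the full list in one variable fewer. This is why the list runs downwards. -/
theorem isWeaklyRegularMod_esymmList (n : ℕ) : IsWeaklyRegularMod ⊥ (esymmList n n) := by
  induction n with
  | zero => trivial
  | succ n ih =>
    have hX : ∀ i ∈ (Finset.univ : Finset (Fin (n + 1))),
        (MvPolynomial.X i : MvPolynomial (Fin (n + 1)) ℚ) ≠ 0 := fun i _ => MvPolynomial.X_ne_zero i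
    refine ⟨fun a ha => ?_, ?_⟩
    · rw [esymm_card] at ha
      exact (mul_eq_zero.1 ha).resolve_left (Finset.prod_ne_zero_iff.2 hX)
    · rw [bot_sup_eq, esymm_card]
      refine IsWeaklyRegularMod.prod _ _ hX fun i _ => ?_
      rw [← comap_killVariable]
      refine IsWeaklyRegularMod.of_surjective (killVariable_surjective i) ?_
      exact (congrArg (IsWeaklyRegularMod ⊥) (map_esymmList i n)).mpr ih

end

noncomputable section

/-! ## The graded character of the coinvariant algebra -/

/-- Additivity of the trace in short exact sequences. -/
theorem LinearMap.trace_eq_add_of_exact {k U V W : Type*} [Field k] [AddCommGroup U] [Module k U]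
    [AddCommGroup V] [Module k V] [AddCommGroup W] [Module k W] [Module.Finite k U]
    [Module.Finite k V] [Module.Finite k W] (j : U →ₗ[k] V) (p : V →ₗ[k] W)
    (hj : Function.Injective j) (hp : Function.Surjective p)
    (hjp : ∀ v, p v = 0 ↔ v ∈ LinearMap.range j) (h : U →ₗ[k] U) (f : V →ₗ[k] V) (g : W →ₗ[k] W)
    (hf : f ∘ₗ j = j ∘ₗ h) (hg : p ∘ₗ f = g ∘ₗ p) :
    LinearMap.trace k V f = LinearMap.trace k U h + LinearMap.trace k W g := by
  obtain ⟨s, hs⟩ := LinearMap.exists_rightInverse_of_surjective p (LinearMap.range_eq_top.2 hp)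
  have hs' (w : W) : p (s w) = w := LinearMap.congr_fun hs w
  have hpj (u : U) : p (j u) = 0 := (hjp _).2 ⟨u, rfl⟩
  let e := LinearEquiv.ofInjective j hj
  let r : V →ₗ[k] U := e.symm.toLinearMap ∘ₗ
    (LinearMap.id - s ∘ₗ p).codRestrict (LinearMap.range j)
      (fun v => (hjp _).1 (by simp [hs']))
  have hjr (v : V) : j (r v) = v - s (p v) := by
    have : (e (r v) : V) = v - s (p v) := by simp [r]
    exact this
  have hrj : r ∘ₗ j = LinearMap.id := by
    ext u
    apply hj
    simp [hjr, hpj]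
  -- The section `s` and retraction `r` satisfy `j r + s p = 1`. Cyclicity of the trace then moves
  -- `r` and `p` to the front, where `r j = 1` and `p s = 1` leave `h` and `g`.
  have hid : f = (f ∘ₗ j) ∘ₗ r + (f ∘ₗ s) ∘ₗ p := by
    ext v
    simp [hjr]
  rw [hid, map_add, LinearMap.trace_comp_comm', LinearMap.trace_comp_comm' p, hf,
    ← LinearMap.comp_assoc, ← LinearMap.comp_assoc, hrj, hg, LinearMap.comp_assoc, hs,
    LinearMap.id_comp, LinearMap.comp_id]

open MvPolynomial

section graded

variable {n : ℕ}

theorem homogeneousComponent_mul_of_isHomogeneous {s : MvPolynomial (Fin n) ℚ} {d : ℕ}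
    (hs : s.IsHomogeneous d) (b : MvPolynomial (Fin n) ℚ) (i : ℕ) :
    homogeneousComponent i (s * b) = if d ≤ i then s * homogeneousComponent (i - d) b else 0 := by
  have h1 (j : ℕ) : homogeneousComponent i (s * homogeneousComponent j b) =
      if d + j = i then s * homogeneousComponent j b else 0 := by
    rw [homogeneousComponent_of_mem ((mem_homogeneousSubmodule _ _).2
      (hs.mul (homogeneousComponent_isHomogeneous j b)))]
    simp only [eq_comm]
  conv_lhs => rw [← sum_homogeneousComponent b, Finset.mul_sum, map_sum]
  simp_rw [h1]
  split_ifs with hd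
  · obtain ⟨m, rfl⟩ := Nat.exists_eq_add_of_le hd
    simp only [add_right_inj, Nat.add_sub_cancel_left]
    rw [Finset.sum_ite_eq']
    split_ifs with hm
    · rfl
    · rw [homogeneousComponent_eq_zero, mul_zero]
      simpa using hm
  · exact Finset.sum_eq_zero fun j _ => if_neg (by omega)

/-- The ideal `J` contains the homogeneous components of its elements. -/
def HasComponents (J : Ideal (MvPolynomial (Fin n) ℚ)) : Prop :=
  ∀ f ∈ J, ∀ i, homogeneousComponent i f ∈ J

theorem HasComponents.sup_span {J : Ideal (MvPolynomial (Fin n) ℚ)} (hJ : HasComponents J)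
    {s : MvPolynomial (Fin n) ℚ} {d : ℕ} (hs : s.IsHomogeneous d) :
    HasComponents (J ⊔ Ideal.span {s}) := by
  intro f hf i
  obtain ⟨b, hb⟩ := IsWeaklyRegularMod.mem_sup_span.1 hf
  have h := hJ _ hb i
  rw [map_sub, homogeneousComponent_mul_of_isHomogeneous hs] at h
  rw [IsWeaklyRegularMod.mem_sup_span]
  split_ifs at h
  · exact ⟨_, h⟩
  · exact ⟨0, by simpa using h⟩

/-- The degree `i` part of `ℚ[x₁, …, x_n] / J`. -/
def quotientPiece (J : Ideal (MvPolynomial (Fin n) ℚ)) (i : ℕ) :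
    Submodule ℚ (MvPolynomial (Fin n) ℚ ⧸ J) :=
  (homogeneousSubmodule (Fin n) ℚ i).map (Ideal.Quotient.mkₐ ℚ J).toLinearMap

instance (J : Ideal (MvPolynomial (Fin n) ℚ)) (i : ℕ) : Module.Finite ℚ (quotientPiece J i) :=
  Module.Finite.iff_fg.2 ((homogeneousSubmodule_fg _ _ _).map _)

/-- The ideal `J` is stable under the permutation `σ` of the variables. -/
def IsStable (σ : Equiv.Perm (Fin n)) (J : Ideal (MvPolynomial (Fin n) ℚ)) : Prop :=
  J ≤ J.comap (rename σ : MvPolynomial (Fin n) ℚ →ₐ[ℚ] MvPolynomial (Fin n) ℚ)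

/-- The action of a permutation of the variables on the degree `i` part of the quotient by a stable
ideal. -/
def pieceMap {σ : Equiv.Perm (Fin n)} {J : Ideal (MvPolynomial (Fin n) ℚ)} (hJ : IsStable σ J)
    (i : ℕ) : quotientPiece J i →ₗ[ℚ] quotientPiece J i :=
  (Ideal.quotientMapₐ J (rename σ) hJ : _ →ₐ[ℚ] MvPolynomial (Fin n) ℚ ⧸ J).toLinearMap.restrict
    (by
      rintro _ ⟨f, hf, rfl⟩
      exact ⟨rename σ f, MvPolynomial.IsHomogeneous.rename_isHomogeneous hf, rfl⟩)

theorem IsStable.sup_span {σ : Equiv.Perm (Fin n)} {J : Ideal (MvPolynomial (Fin n) ℚ)}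
    (hJ : IsStable σ J) {s : MvPolynomial (Fin n) ℚ} (hs : rename σ s = s) :
    IsStable σ (J ⊔ Ideal.span {s}) := by
  intro f hf
  obtain ⟨b, hb⟩ := IsWeaklyRegularMod.mem_sup_span.1 hf
  refine IsWeaklyRegularMod.mem_sup_span.2 ⟨rename σ b, ?_⟩
  have := hJ hb
  simpa [hs] using this

/-- Multiplication by `s` gives an exact sequence from the degree i - d piece modulo `J`, through
the degree i piece modulo `J`, onto the degree i piece modulo `(J, s)`. It commutes with `σ` because
`s` is invariant, and traces add. -/
theorem trace_pieceMap_sup_span {σ : Equiv.Perm (Fin n)} {J : Ideal (MvPolynomial (Fin n) ℚ)}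
    (hJ : IsStable σ J) (hJc : HasComponents J) {s : MvPolynomial (Fin n) ℚ} {d : ℕ}
    (hsd : s.IsHomogeneous d) (hs : rename σ s = s) (hreg : ∀ a, s * a ∈ J → a ∈ J) (i : ℕ) :
    LinearMap.trace ℚ _ (pieceMap (hJ.sup_span hs) i) = LinearMap.trace ℚ _ (pieceMap hJ i) -
      if d ≤ i then LinearMap.trace ℚ _ (pieceMap hJ (i - d)) else 0 := by
  have hle : J ≤ J ⊔ Ideal.span {s} := le_sup_left
  let p : quotientPiece J i →ₗ[ℚ] quotientPiece (J ⊔ Ideal.span {s}) i :=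
    (Ideal.Quotient.factorₐ ℚ hle).toLinearMap.restrict (by
      rintro _ ⟨f, hf, rfl⟩
      exact ⟨f, hf, rfl⟩)
  have hp : Function.Surjective p := by
    rintro ⟨_, f, hf, rfl⟩
    exact ⟨⟨_, f, hf, rfl⟩, rfl⟩
  have hcomm : p ∘ₗ pieceMap hJ i = pieceMap (hJ.sup_span hs) i ∘ₗ p := by
    ext ⟨_, f, hf, rfl⟩
    rfl
  -- Since `J` is homogeneous, a cofactor `b` of `s` can be replaced by its component of degree `i -
  -- d`. The left alternative is just `f ∈ J`.
  have hker (f : MvPolynomial (Fin n) ℚ) (hf : f ∈ homogeneousSubmodule (Fin n) ℚ i) :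
      p ⟨_, f, hf, rfl⟩ = 0 ↔ f - (if d ≤ i then s * homogeneousComponent (i - d) 0 else 0) ∈ J ∨
        ∃ b, f - (if d ≤ i then s * homogeneousComponent (i - d) b else 0) ∈ J := by
    have h1 : p ⟨_, f, hf, rfl⟩ = 0 ↔ f ∈ J ⊔ Ideal.span {s} := by
      rw [← Ideal.Quotient.eq_zero_iff_mem, Subtype.ext_iff]
      rfl
    rw [h1]
    constructor
    · intro h
      obtain ⟨b, hb⟩ := IsWeaklyRegularMod.mem_sup_span.1 h
      refine Or.inr ⟨b, ?_⟩
      have := hJc _ hb i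
      rwa [map_sub, homogeneousComponent_eq_self hf,
        homogeneousComponent_mul_of_isHomogeneous hsd] at this
    · rintro (h | ⟨b, h⟩)
      · exact hle (by simpa using h)
      · rw [IsWeaklyRegularMod.mem_sup_span]
        split_ifs at h
        · exact ⟨_, h⟩
        · exact ⟨0, by simpa using h⟩
  split_ifs with hd
  · obtain ⟨m, rfl⟩ := Nat.exists_eq_add_of_le hd
    simp only [Nat.add_sub_cancel_left, if_pos hd] at hker ⊢
    let j : quotientPiece J m →ₗ[ℚ] quotientPiece J (d + m) :=
      (LinearMap.mulLeft ℚ (Ideal.Quotient.mk J s)).restrict (by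
        rintro _ ⟨f, hf, rfl⟩
        exact ⟨s * f, hsd.mul hf, map_mul (Ideal.Quotient.mk J) _ _⟩)
    rw [eq_sub_iff_add_eq', congrArg (fun i => LinearMap.trace ℚ _ (pieceMap hJ i))
      (Nat.add_sub_cancel_left d m)]
    refine (LinearMap.trace_eq_add_of_exact j p ?_ hp ?_ _ _ _ ?_ hcomm).symm
    · rw [← LinearMap.ker_eq_bot, LinearMap.ker_eq_bot']
      rintro ⟨_, f, hf, rfl⟩ h
      have h1 : Ideal.Quotient.mk J (s * f) = 0 := Subtype.ext_iff.1 h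
      rw [Ideal.Quotient.eq_zero_iff_mem] at h1
      exact Subtype.ext (Ideal.Quotient.eq_zero_iff_mem.2 (hreg _ h1))
    · rintro ⟨_, f, hf, rfl⟩
      rw [hker f hf]
      constructor
      · rintro (h | ⟨b, h⟩)
        · refine ⟨0, Subtype.ext ?_⟩
          have : f ∈ J := by simpa using h
          exact (map_zero _).trans (Ideal.Quotient.eq_zero_iff_mem.2 this).symm
        · refine ⟨⟨_, homogeneousComponent m b, homogeneousComponent_mem m b, rfl⟩, Subtype.ext ?_⟩
          have := (Ideal.Quotient.eq (I := J)).2 h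
          exact (map_mul (Ideal.Quotient.mk J) _ _).symm.trans this.symm
      · rintro ⟨⟨_, g, hg, rfl⟩, h⟩
        refine Or.inr ⟨g, ?_⟩
        rw [homogeneousComponent_eq_self hg]
        have h1 : Ideal.Quotient.mk J (s * g) = Ideal.Quotient.mk J f := Subtype.ext_iff.1 h
        exact (Ideal.Quotient.eq (I := J)).1 h1.symm
    · ext ⟨_, g, hg, rfl⟩
      change Ideal.Quotient.mk J (rename σ (s * g)) =
        Ideal.Quotient.mk J s * Ideal.Quotient.mk J (rename σ g)
      rw [map_mul, hs, map_mul]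
  · simp only [if_neg hd, sub_zero] at hker ⊢
    -- Below degree `d` no multiple of `s` occurs, so the sequence has zero as its left term.
    have := LinearMap.trace_eq_add_of_exact (U := PUnit.{1}) 0 p (fun _ _ _ => Subsingleton.elim _ _)
      hp (by
        rintro ⟨_, f, hf, rfl⟩
        rw [hker f hf, LinearMap.range_zero, Submodule.mem_bot, exists_const, or_self,
          ← Ideal.Quotient.eq_zero_iff_mem, Subtype.ext_iff]
        rfl) 0 (pieceMap hJ i) (pieceMap (hJ.sup_span hs) i) (by simp) hcomm
    rw [this, map_zero, zero_add]

/-- The generating function of the traces of `σ` on the graded pieces of the quotient by `J`. -/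
def gradedTrace {σ : Equiv.Perm (Fin n)} {J : Ideal (MvPolynomial (Fin n) ℚ)} (hJ : IsStable σ J) :
    PowerSeries ℚ :=
  PowerSeries.mk fun i => LinearMap.trace ℚ _ (pieceMap hJ i)

theorem gradedTrace_sup_span {σ : Equiv.Perm (Fin n)} {J : Ideal (MvPolynomial (Fin n) ℚ)}
    (hJ : IsStable σ J) (hJc : HasComponents J) {s : MvPolynomial (Fin n) ℚ} {d : ℕ}
    (hsd : s.IsHomogeneous d) (hs : rename σ s = s) (hreg : ∀ a, s * a ∈ J → a ∈ J) :
    gradedTrace (hJ.sup_span hs) = (1 - PowerSeries.X ^ d) * gradedTrace hJ := by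
  ext i
  rw [sub_mul, one_mul, map_sub, PowerSeries.coeff_X_pow_mul', gradedTrace, gradedTrace,
    PowerSeries.coeff_mk, PowerSeries.coeff_mk, PowerSeries.coeff_mk,
    trace_pieceMap_sup_span hJ hJc hsd hs hreg]

theorem isHomogeneous_esymm (m : ℕ) : (esymm (Fin n) ℚ m).IsHomogeneous m := by
  rw [esymm]
  refine IsHomogeneous.sum _ _ _ fun t ht => ?_
  have h := IsHomogeneous.prod (R := ℚ) t (fun i => X i) (fun _ => 1) fun i _ => isHomogeneous_X ℚ i
  simpa [(Finset.mem_powersetCard.1 ht).2] using h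

/-- Each generator contributes its factor. The final ideal is a separate variable `J'` tied by an
equation, so that it can later be the symmetric ideal with its own stability proof. -/
theorem gradedTrace_esymmList {σ : Equiv.Perm (Fin n)} (m : ℕ)
    {J J' : Ideal (MvPolynomial (Fin n) ℚ)} (hJ : IsStable σ J) (hJc : HasComponents J)
    (hreg : IsWeaklyRegularMod J (esymmList n m)) (hJ' : IsStable σ J')
    (h : J' = J ⊔ Ideal.ofList (esymmList n m)) :
    gradedTrace hJ' =
      (∏ i ∈ Finset.range m, (1 - PowerSeries.X ^ (i + 1))) * gradedTrace hJ := by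
  induction m generalizing J with
  | zero =>
    have : J' = J := by simpa [esymmList] using h
    subst this
    simp
  | succ m ih =>
    have hs : rename σ (esymm (Fin n) ℚ (m + 1)) = esymm (Fin n) ℚ (m + 1) := rename_esymm _ _ _ σ
    have hd := isHomogeneous_esymm (n := n) (m + 1)
    rw [esymmList, Ideal.ofList_cons, ← sup_assoc] at h
    rw [ih (hJ.sup_span hs) (hJc.sup_span hd) hreg.2 h,
      gradedTrace_sup_span hJ hJc hd hs hreg.1, Finset.prod_range_succ, mul_assoc]

/-- By the fundamental theorem a symmetric polynomial is g(e_1, …, e_n). Modulo the e_k it is the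
constant term of g, which is also its own constant term because the e_k have none. -/
theorem ofList_esymmList (n : ℕ) : Ideal.ofList (esymmList n n) = symmetricIdeal n := by
  have hmem : ∀ m, ∀ f ∈ esymmList n m, ∃ k, f = esymm (Fin n) ℚ (k + 1) := by
    intro m
    induction m with
    | zero => simp [esymmList]
    | succ m ih =>
      intro f hf
      rcases List.mem_cons.1 hf with rfl | hf
      exacts [⟨m, rfl⟩, ih f hf]
  have hmem' : ∀ m, ∀ k < m, esymm (Fin n) ℚ (k + 1) ∈ esymmList n m := by
    intro m
    induction m with
    | zero => intro k hk; omega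
    | succ m ih =>
      intro k hk
      rcases Nat.lt_succ_iff_lt_or_eq.1 hk with h | rfl
      · exact List.mem_cons_of_mem _ (ih k h)
      · exact List.mem_cons_self
  have hcc (k : ℕ) : constantCoeff (esymm (Fin n) ℚ (k + 1)) = 0 := by
    rw [constantCoeff_eq]
    exact (isHomogeneous_esymm (k + 1)).coeff_eq_zero (by simp)
  refine le_antisymm (Ideal.span_le.2 fun f hf => ?_) (Ideal.span_le.2 ?_)
  · obtain ⟨k, rfl⟩ := hmem n f hf
    exact Ideal.subset_span ⟨esymm_isSymmetric _ _ _, hcc k⟩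
  · rintro f ⟨hf, hc⟩
    obtain ⟨g, hg⟩ := esymmAlgHom_surjective (σ := Fin n) (n := n) ℚ (by simp) ⟨f, hf⟩
    have hfg : aeval (fun i : Fin n => esymm (Fin n) ℚ (i + 1)) g = f := by
      rw [← esymmAlgHom_apply, hg]
    have key (g : MvPolynomial (Fin n) ℚ) :
        aeval (fun i : Fin n => esymm (Fin n) ℚ (i + 1)) g - C (constantCoeff g) ∈
          Ideal.ofList (esymmList n n) := by
      induction g using MvPolynomial.induction_on with
      | C a => simp
      | add p q hp hq =>
        rw [map_add, map_add, map_add, add_sub_add_comm]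
        exact Ideal.add_mem _ hp hq
      | mul_X p i hp =>
        rw [map_mul, map_mul, aeval_X, constantCoeff_X, mul_zero, map_zero, sub_zero]
        exact Ideal.mul_mem_left _ _ (Ideal.subset_span (hmem' n i i.2))
    have hc' : constantCoeff g = 0 := by
      have h1 : ∀ g : MvPolynomial (Fin n) ℚ, constantCoeff
          (aeval (fun i : Fin n => esymm (Fin n) ℚ (i + 1)) g) = constantCoeff g := by
        intro g
        induction g using MvPolynomial.induction_on with
        | C a => simp
        | add p q hp hq => simp only [map_add, hp, hq]
        | mul_X p i hp => rw [map_mul, map_mul, map_mul, aeval_X, hcc, constantCoeff_X]; simp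
      rw [← h1, hfg, hc]
    have := key g
    rwa [hfg, hc', map_zero, sub_zero] at this

end graded

end

/-! ### Fixed monomials and the graded character of the polynomial ring -/

noncomputable section

open MvPolynomial

section fixedMonomials

variable {n : ℕ}

/-- The exponents of the monomials of degree `i`. -/
abbrev MonomialExponent (n i : ℕ) : Type := {d : Fin n →₀ ℕ // d.degree = i}

theorem Finsupp.degree_eq_sum_univ (d : Fin n →₀ ℕ) : d.degree = ∑ j, d j :=
  Finset.sum_subset (Finset.subset_univ _) fun _ _ hj => Finsupp.notMem_support_iff.1 hj

instance (i : ℕ) : Fintype (MonomialExponent n i) :=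
  Fintype.ofFinset ((Finset.univ : Finset (Fin n)).finsuppAntidiag i) fun d => by
    rw [Finset.mem_finsuppAntidiag]
    change _ ↔ d.degree = i
    rw [Finsupp.degree_eq_sum_univ]
    simp

/-- The action of a permutation of the variables on exponents. -/
def exponentPerm (σ : Equiv.Perm (Fin n)) (i : ℕ) : Equiv.Perm (MonomialExponent n i) :=
  (Finsupp.domCongr σ : (Fin n →₀ ℕ) ≃+ (Fin n →₀ ℕ)).toEquiv.subtypeEquiv fun d => by
    rw [Finsupp.degree_eq_sum_univ, Finsupp.degree_eq_sum_univ]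
    have : ∑ j, d j = ∑ j, (Finsupp.domCongr σ d) j := by
      rw [← Equiv.sum_comp σ fun j => (Finsupp.domCongr σ d) j]
      simp
    rw [this]
    rfl

theorem exponentPerm_val (σ : Equiv.Perm (Fin n)) (i : ℕ) (d : MonomialExponent n i) :
    (exponentPerm σ i d).1 = Finsupp.mapDomain σ d.1 := by
  change Finsupp.equivMapDomain σ d.1 = _
  exact Finsupp.equivMapDomain_eq_mapDomain _ _

theorem isStable_bot (σ : Equiv.Perm (Fin n)) : IsStable σ ⊥ := bot_le

/-- The isomorphism from coefficient vectors to homogeneous polynomials. -/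
def pieceOfCoeffs (n i : ℕ) : (MonomialExponent n i → ℚ) →ₗ[ℚ] quotientPiece (n := n) ⊥ i where
  toFun g := ⟨Ideal.Quotient.mk ⊥ (∑ d, monomial d.1 (g d)), _,
    (homogeneousSubmodule (Fin n) ℚ i).sum_mem fun d _ => isHomogeneous_monomial _ d.2, rfl⟩
  map_add' g h := by
    ext1
    simp only [Pi.add_apply, Finset.sum_add_distrib, map_add]
    rfl
  map_smul' a g := by
    ext1
    simp only [Pi.smul_apply, ← MvPolynomial.smul_monomial, ← Finset.smul_sum]
    rfl

theorem coeff_sum_monomial (i : ℕ) (g : MonomialExponent n i → ℚ) (d : MonomialExponent n i) :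
    coeff d.1 (∑ d, monomial d.1 (g d)) = g d := by
  classical
  rw [coeff_sum, Finset.sum_eq_single d]
  · rw [coeff_monomial, if_pos rfl]
  · intro b _ hb
    rw [coeff_monomial, if_neg fun h => hb (Subtype.ext h)]
  · simp

theorem pieceOfCoeffs_bijective (n i : ℕ) : Function.Bijective (pieceOfCoeffs n i) := by
  constructor
  · intro g h hgh
    have h1 := (Ideal.Quotient.eq (I := ⊥)).1 (Subtype.ext_iff.1 hgh)
    rw [Ideal.mem_bot, sub_eq_zero] at h1
    funext d
    rw [← coeff_sum_monomial i g d, h1, coeff_sum_monomial]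
  · rintro ⟨_, f, hf, rfl⟩
    refine ⟨fun d => coeff d.1 f, Subtype.ext (congrArg (Ideal.Quotient.mk ⊥) ?_)⟩
    ext d
    by_cases hd : d.degree = i
    · exact coeff_sum_monomial i _ ⟨d, hd⟩
    · have hf' : f.IsHomogeneous i := hf
      rw [hf'.coeff_eq_zero hd, coeff_sum]
      refine Finset.sum_eq_zero fun b _ => ?_
      classical
      rw [coeff_monomial, if_neg]
      rintro rfl
      exact hd b.2

/-- The monomials form a basis permuted by `σ`. The trace is carried over to coefficient vectors by
the additivity lemma with zero quotient. -/
theorem trace_pieceMap_bot (σ : Equiv.Perm (Fin n)) (i : ℕ) :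
    LinearMap.trace ℚ _ (pieceMap (isStable_bot σ) i) =
      Nat.card {d : MonomialExponent n i // exponentPerm σ i d = d} := by
  classical
  let h : (MonomialExponent n i → ℚ) →ₗ[ℚ] (MonomialExponent n i → ℚ) :=
    LinearMap.funLeft ℚ ℚ (exponentPerm σ i).symm
  have hcomm : pieceMap (isStable_bot σ) i ∘ₗ pieceOfCoeffs n i = pieceOfCoeffs n i ∘ₗ h := by
    refine LinearMap.ext fun g => Subtype.ext ?_
    change Ideal.Quotient.mk ⊥ (rename σ (∑ d, monomial d.1 (g d))) =
      Ideal.Quotient.mk ⊥ (∑ d, monomial d.1 (g ((exponentPerm σ i).symm d)))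
    congr 1
    rw [map_sum, ← Equiv.sum_comp (exponentPerm σ i)
      fun d => monomial d.1 (g ((exponentPerm σ i).symm d))]
    refine Finset.sum_congr rfl fun d _ => ?_
    rw [rename_monomial, Equiv.symm_apply_apply, exponentPerm_val]
  have h1 := LinearMap.trace_eq_add_of_exact (W := PUnit.{1}) (pieceOfCoeffs n i) 0
    (pieceOfCoeffs_bijective n i).1 (fun _ => ⟨0, Subsingleton.elim _ _⟩)
    (fun v => by simpa using (pieceOfCoeffs_bijective n i).2 v) h _ 0 hcomm (by simp)
  rw [h1, map_zero, add_zero, LinearMap.trace_eq_matrix_trace ℚ (Pi.basisFun ℚ _), Matrix.trace,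
    Nat.card_eq_fintype_card, Fintype.card_subtype, Finset.card_filter, Nat.cast_sum]
  refine Finset.sum_congr rfl fun d _ => ?_
  rw [Matrix.diag_apply, LinearMap.toMatrix_apply, Pi.basisFun_apply, Pi.basisFun_repr]
  simp only [h, LinearMap.funLeft_apply, Pi.single_apply, Equiv.symm_apply_eq]
  simp [eq_comm]

theorem exponentPerm_eq_self_iff (σ : Equiv.Perm (Fin n)) (i : ℕ) (d : MonomialExponent n i) :
    exponentPerm σ i d = d ↔ ∀ j, d.1 (σ j) = d.1 j := by
  rw [Subtype.ext_iff, exponentPerm_val]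
  constructor
  · intro h j
    conv_lhs => rw [← h]
    exact Finsupp.mapDomain_apply σ.injective _ _
  · intro h
    ext j
    obtain ⟨j, rfl⟩ := σ.surjective j
    rw [Finsupp.mapDomain_apply σ.injective, h]

theorem apply_eq_of_cycleAt {α : Type*} {σ : Equiv.Perm (Fin n)} {d : Fin n → α}
    (hd : ∀ j, d (σ j) = d j) (j : Fin n) : d (cycleAt σ j).out = d j := by
  obtain ⟨m, -, hm⟩ := PermCycle.exists_iterate_out σ j
  conv_rhs => rw [← hm]
  generalize (cycleAt σ j).out = r
  clear hm
  induction m with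
  | zero => rfl
  | succ m ih => rw [Function.iterate_succ_apply', hd, ← ih]

theorem sum_eq_sum_cycles (σ : Equiv.Perm (Fin n)) (f : PermCycle σ → ℕ) :
    ∑ j, f (cycleAt σ j) = ∑ c, PermCycle.size c * f c := by
  classical
  rw [← Finset.sum_fiberwise Finset.univ (cycleAt σ)]
  refine Finset.sum_congr rfl fun c _ => ?_
  rw [Finset.sum_congr rfl fun j hj => by rw [(Finset.mem_filter.1 hj).2], Finset.sum_const,
    smul_eq_mul, PermCycle.size, Nat.card_eq_fintype_card, Fintype.card_subtype]

/-- A monomial is fixed when its exponent is constant on cycles. Recording for each cycle its total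
exponent, size times the common value, gives exactly the tuples with sum `i` and entries divisible
by the sizes, which the product of geometric series counts. -/
theorem gradedTrace_bot (σ : Equiv.Perm (Fin n)) :
    gradedTrace (isStable_bot σ) =
      ∏ c : PermCycle σ, (1 - PowerSeries.X ^ PermCycle.size c : PowerSeries ℚ)⁻¹ := by
  classical
  ext i
  rw [gradedTrace, PowerSeries.coeff_mk, trace_pieceMap_bot, PowerSeries.coeff_prod]
  simp_rw [PowerSeries.coeff_inv_one_sub_X_pow (PermCycle.size_pos _), Finset.prod_ite_zero,
    Finset.prod_const_one]
  rw [← Finset.sum_filter, Finset.sum_const, nsmul_one, Nat.card_eq_fintype_card,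
    Fintype.card_subtype]
  congr 1
  refine Finset.card_bij' (fun d _ => Finsupp.equivFunOnFinite.symm
      fun c => PermCycle.size c * d.1 c.out)
    (fun l hl => ⟨Finsupp.equivFunOnFinite.symm
      fun j => l (cycleAt σ j) / PermCycle.size (cycleAt σ j), ?_⟩) ?_ ?_ ?_ ?_
  · have hl' := Finset.mem_filter.1 hl
    rw [Finsupp.degree_eq_sum_univ]
    simp only [Finsupp.equivFunOnFinite_symm_apply_apply]
    rw [sum_eq_sum_cycles σ fun c => l c / PermCycle.size c,
      Finset.sum_congr rfl fun c hc => Nat.mul_div_cancel' (hl'.2 c hc)]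
    exact (Finset.mem_finsuppAntidiag.1 hl'.1).1
  · intro d hd
    have hd' := (exponentPerm_eq_self_iff σ i d).1 (Finset.mem_filter.1 hd).2
    refine Finset.mem_filter.2 ⟨Finset.mem_finsuppAntidiag.2 ⟨?_, Finset.subset_univ _⟩,
      fun c _ => ?_⟩
    · simp only [Finsupp.equivFunOnFinite_symm_apply_apply]
      rw [← sum_eq_sum_cycles σ fun c => d.1 c.out,
        Finset.sum_congr rfl fun j _ => apply_eq_of_cycleAt hd' j, ← Finsupp.degree_eq_sum_univ]
      exact d.2
    · simp
  · intro l hl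
    refine Finset.mem_filter.2 ⟨Finset.mem_univ _, (exponentPerm_eq_self_iff σ i _).2 fun j => ?_⟩
    have : cycleAt σ (σ j) = cycleAt σ j := mk_iterate σ 1 j
    simp only [Finsupp.equivFunOnFinite_symm_apply_apply, this]
  · intro d hd
    have hd' := (exponentPerm_eq_self_iff σ i d).1 (Finset.mem_filter.1 hd).2
    refine Subtype.ext (Finsupp.ext fun j => ?_)
    simp only [Finsupp.equivFunOnFinite_symm_apply_apply]
    rw [Nat.mul_div_cancel_left _ (PermCycle.size_pos _), apply_eq_of_cycleAt hd']
  · intro l hl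
    ext c
    simp only [Finsupp.equivFunOnFinite_symm_apply_apply, cycleAt_out]
    exact Nat.mul_div_cancel' ((Finset.mem_filter.1 hl).2 c (Finset.mem_univ _))

/-- The graded character of the coinvariant algebra. -/
theorem mk_character_coinvariantRep (σ : Equiv.Perm (Fin n)) :
    PowerSeries.mk (fun i => (coinvariantRep n i).character σ) =
      (∏ i ∈ Finset.range n, (1 - PowerSeries.X ^ (i + 1))) *
        ∏ c : PermCycle σ, (1 - PowerSeries.X ^ PermCycle.size c : PowerSeries ℚ)⁻¹ := by
  rw [← gradedTrace_bot]
  -- `coinvariantRep` is by definition `pieceMap` for the symmetric ideal, so the left side is its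
  -- `gradedTrace`.
  exact gradedTrace_esymmList n (isStable_bot σ) (fun f hf i => by
      rw [(Ideal.mem_bot).1 hf, map_zero]; exact Ideal.zero_mem _)
    (isWeaklyRegularMod_esymmList n) (symmetricIdeal_le_comap n σ)
    (by rw [bot_sup_eq, ofList_esymmList])

theorem coinvariantMultiplicity_eq_coeff (P : CharacterPolynomial) (n i : ℕ) :
    coinvariantMultiplicity P n i = PowerSeries.coeff i
      (twistedMean PowerSeries.X (fun k => (1 - PowerSeries.X ^ k)⁻¹) P 0 n) := by
  have h1 (σ : Equiv.Perm (Fin n)) : (coinvariantRep n i).character σ = PowerSeries.coeff i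
      ((∏ i ∈ Finset.range n, (1 - PowerSeries.X ^ (i + 1))) *
        ((cycleSizes σ).map fun k => (1 - PowerSeries.X ^ k : PowerSeries ℚ)⁻¹).prod) := by
    rw [prod_map_cycleSizes, ← mk_character_coinvariantRep, PowerSeries.coeff_mk]
  have h2 := sum_perm_cycleSizes n fun m => (∏ i ∈ Finset.range n, (1 - PowerSeries.X ^ (i + 1))) *
    (P.evalCounts m • (m.map fun k => (1 - PowerSeries.X ^ k : PowerSeries ℚ)⁻¹).prod)
  have h3 : ∑ σ : Equiv.Perm (Fin n), P.evalPerm σ * (coinvariantRep n i).character σ =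
      n.factorial * PowerSeries.coeff i
        (twistedMean PowerSeries.X (fun k => (1 - PowerSeries.X ^ k)⁻¹) P 0 n) := by
    have h4 := congrArg (PowerSeries.coeff i) h2
    rw [map_sum, PowerSeries.coeff_smul, smul_eq_mul] at h4
    simp only [twistedMean, zero_add]
    rw [← partitionMean_mul_left]
    refine Eq.trans (Finset.sum_congr rfl fun σ _ => ?_) h4
    rw [h1, CharacterPolynomial.evalPerm_eq_evalCounts, mul_smul_comm, PowerSeries.coeff_smul,
      smul_eq_mul]
  rw [coinvariantMultiplicity, h3, mul_div_cancel_left₀]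
  exact_mod_cast n.factorial_ne_zero

end fixedMonomials

end

noncomputable section

/-! ## Fixed vectors of Frobenius-semilinear maps -/

section frobeniusFixed

open Polynomial in
-- The polynomial μ X^Q - X has derivative -1, hence is separable and has as many roots as its
-- degree.
theorem card_mul_pow_eq {K : Type*} [Field K] [IsAlgClosed K] {Q : ℕ} (hQ : 1 < Q)
    (hQ0 : (Q : K) = 0) {μ : K} (hμ : μ ≠ 0) : Nat.card {x : K // μ * x ^ Q = x} = Q := by
  classical
  set p : K[X] := C μ * X ^ Q - X with hp
  have hdeg : p.natDegree = Q := by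
    have h1 : (C μ * X ^ Q : K[X]).natDegree = Q := natDegree_C_mul_X_pow Q μ hμ
    rw [hp, natDegree_sub_eq_left_of_natDegree_lt (by rw [h1, natDegree_X]; exact hQ), h1]
  have hp0 : p ≠ 0 := by
    intro h
    rw [h, natDegree_zero] at hdeg
    omega
  have hder : derivative p = -1 := by
    rw [hp, derivative_sub, derivative_C_mul_X_pow, derivative_X, hQ0]
    simp
  have hsep : p.Separable := by
    rw [Separable, hder]
    exact isCoprime_one_right.neg_right
  have h := card_rootSet_eq_natDegree (K := K) hsep (by
    rw [Algebra.algebraMap_self, Polynomial.map_id]; exact IsAlgClosed.splits p)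
  rw [hdeg, ← Nat.card_eq_fintype_card] at h
  refine Eq.trans (Nat.card_congr (Equiv.subtypeEquivRight fun x => ?_)) h
  rw [mem_rootSet, and_iff_right hp0, hp]
  simp [sub_eq_zero]

theorem card_units_mul_pow_eq {K : Type*} [Field K] [IsAlgClosed K] {Q : ℕ} (hQ : 1 < Q)
    (hQ0 : (Q : K) = 0) (μ : Kˣ) : Nat.card {x : Kˣ // μ * x ^ Q = x} = Q - 1 := by
  classical
  have hcard := card_mul_pow_eq hQ hQ0 μ.ne_zero
  have : Finite {x : K // (μ : K) * x ^ Q = x} := Nat.finite_of_card_ne_zero (by omega)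
  have : Fintype {x : K // (μ : K) * x ^ Q = x} := Fintype.ofFinite _
  let z : {x : K // (μ : K) * x ^ Q = x} := ⟨0, by rw [zero_pow (by omega), mul_zero]⟩
  have hne : Nat.card {x // x ≠ z} = Q - 1 := by
    have := Set.card_ne_eq z
    rw [← Nat.card_eq_fintype_card, ← Nat.card_eq_fintype_card, hcard] at this
    exact this
  rw [← hne]
  refine Nat.card_congr ⟨fun x => ⟨⟨x.1, by exact_mod_cast congrArg Units.val x.2⟩, fun h =>
      x.1.ne_zero (congrArg Subtype.val h)⟩,
    fun x => ⟨Units.mk0 x.1.1 fun h => x.2 (Subtype.ext h), Units.ext x.1.2⟩, fun x => ?_,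
    fun x => ?_⟩
  · ext; rfl
  · ext; rfl

variable {F : Type*} [Field F] [Fintype F]

local notation "q" => Fintype.card F

theorem one_lt_card_pow {d : ℕ} (hd : 0 < d) : 1 < q ^ d :=
  Nat.one_lt_pow hd.ne' Fintype.one_lt_card

theorem cast_card_pow_eq_zero (K : Type*) [Field K] [Algebra F K] {d : ℕ} (hd : 0 < d) :
    ((q ^ d : ℕ) : K) = 0 := by
  rw [Nat.cast_pow, ← map_natCast (algebraMap F K), FiniteField.cast_card_eq_zero, map_zero,
    zero_pow hd.ne']

/-- Going `m` steps around a cycle yields a single map of the same shape with exponent `r ^ m`. A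
monoid `M` is allowed so that both `K` and `Kˣ` are covered. -/
theorem skewMap_iterate_mul_pow {ι M : Type*} [CommMonoid M] (w : Equiv.Perm ι) (r : ℕ)
    (μ : ι → Mˣ) (m : ℕ) (i : ι) : ∃ ν : Mˣ, ∀ x : M,
      ((skewMap w fun i x => (μ i : M) * x ^ r)^[m] (i, x)).2 = ν * x ^ r ^ m := by
  induction m with
  | zero => exact ⟨1, fun x => by simp⟩
  | succ m ih =>
    obtain ⟨ν, hν⟩ := ih
    refine ⟨μ (w^[m] i) * ν ^ r, fun x => ?_⟩
    rw [Function.iterate_succ_apply', skewMap, skewMap_iterate_fst, hν, mul_pow, ← pow_mul,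
      Units.val_mul, Units.val_pow_eq_pow_val, mul_assoc, pow_succ]

variable {K : Type*} [Field K] [Algebra F K] [IsAlgClosed K]

variable (F K) in
theorem card_frobenius_fixed {ι : Type*} [Fintype ι] (w : Equiv.Perm ι) :
    Nat.card {a : ι → K // ∀ i, a (w i) = a i ^ q} = q ^ Fintype.card ι := by
  have h1 : Nat.card {a : ι → K // ∀ i, a (w i) = a i ^ q} =
      Nat.card {a : ι → K // ∀ i, a (w i) = ((1 : Kˣ) : K) * a i ^ q} := by simp
  rw [h1, card_equivariant w fun _ x => ((1 : Kˣ) : K) * x ^ q]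
  have h2 (c : PermCycle w) : Nat.card {x : K //
      ((skewMap w fun _ x => ((1 : Kˣ) : K) * x ^ q)^[c.size] (c.out, x)).2 = x} = q ^ c.size := by
    obtain ⟨ν, hν⟩ := skewMap_iterate_mul_pow w q (fun _ => (1 : Kˣ)) c.size c.out
    simp_rw [hν]
    exact card_mul_pow_eq (one_lt_card_pow c.size_pos) (cast_card_pow_eq_zero K c.size_pos)
      ν.ne_zero
  rw [Finset.prod_congr rfl fun c _ => h2 c, Finset.prod_pow_eq_pow_sum, ← sum_cycleSizes w]
  rfl

variable (F) in
theorem card_frobenius_fixed_units {ι : Type*} [Finite ι] (w : Equiv.Perm ι) (μ : ι → Kˣ) :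
    Nat.card {a : ι → Kˣ // ∀ i, a (w i) = μ i * a i ^ q} =
      ∏ c : PermCycle w, (q ^ c.size - 1) := by
  rw [card_equivariant w fun i x => μ i * x ^ q]
  refine Finset.prod_congr rfl fun c _ => ?_
  obtain ⟨ν, hν⟩ := skewMap_iterate_mul_pow w q (fun i => toUnits (μ i)) c.size c.out
  have hν' : ∀ x : Kˣ, ((skewMap w fun i x => μ i * x ^ q)^[c.size] (c.out, x)).2 =
    (ν : Kˣ) * x ^ q ^ c.size := hν
  simp_rw [hν']
  exact card_units_mul_pow_eq (one_lt_card_pow c.size_pos) (cast_card_pow_eq_zero K c.size_pos) _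

theorem mem_range_algebraMap_of_pow_eq {x : K} (hx : x ^ q = x) : ∃ a : F, algebraMap F K a = x := by
  have hcard := card_mul_pow_eq (one_lt_card_pow (F := F) one_pos)
    (cast_card_pow_eq_zero K (F := F) one_pos) (one_ne_zero (α := K))
  have : Finite {x : K // 1 * x ^ q ^ 1 = x} :=
    Nat.finite_of_card_ne_zero (by have := one_lt_card_pow (F := F) one_pos; omega)
  let f : F → {x : K // 1 * x ^ q ^ 1 = x} := fun a =>
    ⟨algebraMap F K a, by rw [one_mul, pow_one, ← map_pow, FiniteField.pow_card]⟩
  have hf : Function.Injective f := fun a b h =>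
    (algebraMap F K).injective (congrArg Subtype.val h)
  obtain ⟨a, ha⟩ := (hf.bijective_of_nat_card_le
    (by rw [hcard, pow_one, Nat.card_eq_fintype_card])).2 ⟨x, by rw [one_mul, pow_one, hx]⟩
  exact ⟨a, congrArg Subtype.val ha⟩

/-- The vectors fixed by the composite of the Frobenius map and a permutation of the coordinates. -/
def frobeniusFixed (F K : Type*) [Field F] [Fintype F] [Field K] [Algebra F K] {ι : Type*}
    (w : Equiv.Perm ι) : Submodule F (ι → K) where
  carrier := {a | ∀ i, a (w i) = a i ^ Fintype.card F}
  add_mem' {a b} ha hb i := by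
    rw [Pi.add_apply, Pi.add_apply, ha, hb]
    exact (map_add (FiniteField.frobeniusAlgHom F K) (a i) (b i)).symm
  zero_mem' i := by simp
  smul_mem' c a ha i := by
    rw [Pi.smul_apply, Pi.smul_apply, ha]
    exact (map_smul (FiniteField.frobeniusAlgHom F K) c (a i)).symm

/-- Descent: if the last vector is ∑ c_j r_j with the r_j independent over `K`, the twisted
Frobenius fixes all these vectors and replaces c_j by c_j^q. Uniqueness forces c_j^q = c_j, so the
relation is already over `F`. -/
theorem linearIndependent_frobeniusFixed_iff {ι : Type*} (w : Equiv.Perm ι) {m : ℕ}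
    (r : Fin m → frobeniusFixed F K w) :
    LinearIndependent K (fun j => (r j : ι → K)) ↔ LinearIndependent F r := by
  constructor
  · intro h
    refine LinearIndependent.of_comp (frobeniusFixed F K w).subtype ?_
    exact h.restrict_scalars fun a b hab => by
      simpa [Algebra.smul_def] using hab
  · intro h
    induction m with
    | zero => exact linearIndependent_empty_type
    | succ m ih =>
      rw [linearIndependent_finSucc'] at h ⊢
      have ih' := ih (Fin.init r) h.1
      refine ⟨ih', fun hmem => h.2 ?_⟩
      obtain ⟨c, hc⟩ := (Submodule.mem_span_range_iff_exists_fun K).1 hmem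
      have hc1 (i : ι) : ∑ j, c j * (r j.castSucc).1 i = (r (Fin.last m)).1 i := by
        simpa [Fin.init] using congrFun hc i
      have hc2 : ∑ j, (c j ^ q) • ((Fin.init r j : frobeniusFixed F K w) : ι → K) =
          (r (Fin.last m)).1 := by
        funext i
        obtain ⟨i, rfl⟩ := w.surjective i
        rw [(r (Fin.last m)).2 i, ← hc1]
        have := map_sum (FiniteField.frobeniusAlgHom F K) (fun j => c j * (r j.castSucc).1 i)
          Finset.univ
        simp only [FiniteField.coe_frobeniusAlgHom] at this
        rw [this, Finset.sum_apply]
        refine Finset.sum_congr rfl fun j _ => ?_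
        rw [Pi.smul_apply, smul_eq_mul, mul_pow]
        congr 1
        exact (r j.castSucc).2 i
      have hcj (j : Fin m) : c j ^ q = c j := by
        have h0 : ∑ j, (c j ^ q - c j) • ((Fin.init r j : frobeniusFixed F K w) : ι → K) = 0 := by
          simp_rw [sub_smul]
          rw [Finset.sum_sub_distrib, hc2, sub_eq_zero]
          exact hc.symm
        exact sub_eq_zero.1 (Fintype.linearIndependent_iff.1 ih' _ h0 j)
      choose b hb using fun j => mem_range_algebraMap_of_pow_eq (hcj j)
      refine (Submodule.mem_span_range_iff_exists_fun F).2 ⟨b, Subtype.ext ?_⟩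
      rw [← hc]
      simp only [Submodule.coe_sum, Submodule.coe_smul]
      refine Finset.sum_congr rfl fun j _ => ?_
      rw [← hb, algebraMap_smul]
      rfl

variable (F K) in
/-- The number of bases of `K^n` permuted by Frobenius in the way prescribed by `w`. -/
theorem card_frobenius_bases {n : ℕ} (w : Equiv.Perm (Fin n)) :
    Nat.card {v : Fin n → Fin n → K // LinearIndependent K v ∧ ∀ i j, v (w i) j = v i j ^ q} =
      ∏ i : Fin n, (q ^ n - q ^ (i : ℕ)) := by
  have hcard : Nat.card (frobeniusFixed F K w) = q ^ n := by
    have := card_frobenius_fixed F K w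
    rwa [Fintype.card_fin] at this
  have hfin : Finite (frobeniusFixed F K w) := Nat.finite_of_card_ne_zero (by
    rw [hcard]; exact pow_ne_zero _ Fintype.card_ne_zero)
  have hrank : Module.finrank F (frobeniusFixed F K w) = n := by
    have : Fintype (frobeniusFixed F K w) := Fintype.ofFinite _
    rw [Nat.card_eq_fintype_card, Module.card_eq_pow_finrank (K := F)] at hcard
    exact Nat.pow_right_injective Fintype.one_lt_card hcard
  have h := card_linearIndependent (K := F) (V := frobeniusFixed F K w) (k := n) hrank.ge
  rw [hrank] at h
  rw [← h]
  -- The Frobenius condition acts on the frame index, so it is the columns of the matrix of `v` that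
  -- lie in `frobeniusFixed`. Transposing turns the count into that of bases of an n-dimensional
  -- `F`-space, independent of `w`.
  have htr (v : Fin n → Fin n → K) :
      LinearIndependent K v ↔ LinearIndependent K (fun j i => v i j) :=
    (Matrix.linearIndependent_rows_iff_isUnit (A := Matrix.of v)).trans
      (Matrix.linearIndependent_cols_iff_isUnit (A := Matrix.of v)).symm
  refine Nat.card_congr ⟨fun v => ⟨fun j => ⟨fun i => v.1 i j, fun i => v.2.2 i j⟩,
      (linearIndependent_frobeniusFixed_iff w _).1 ((htr _).1 v.2.1)⟩,
    fun r => ⟨fun i j => (r.1 j).1 i, (htr _).2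
      ((linearIndependent_frobeniusFixed_iff w _).2 r.2), fun i j => (r.1 j).2 i⟩,
    fun v => rfl, fun r => rfl⟩

end frobeniusFixed

end

noncomputable section

/-! ## Maximal diagonalizable subgroups of the general linear group -/

section frames

variable {n : ℕ} {K : Type*} [Field K]

/-- The group of invertible matrices for which all the vectors `v i` are eigenvectors. -/
def frameStabilizer (v : Fin n → Fin n → K) : Subgroup (GL (Fin n) K) where
  carrier := {t | ∀ i, ∃ c : Kˣ, (t : Matrix (Fin n) (Fin n) K) *ᵥ v i = (c : K) • v i}
  mul_mem' {s t} hs ht i := by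
    obtain ⟨c, hc⟩ := hs i
    obtain ⟨d, hd⟩ := ht i
    refine ⟨d * c, ?_⟩
    rw [Units.val_mul (α := Matrix (Fin n) (Fin n) K), ← Matrix.mulVec_mulVec, hd,
      Matrix.mulVec_smul, hc, smul_smul, Units.val_mul]
  one_mem' i := ⟨1, by simp⟩
  inv_mem' {t} ht i := by
    obtain ⟨c, hc⟩ := ht i
    refine ⟨c⁻¹, ?_⟩
    have h1 : ((t⁻¹ : GL (Fin n) K) : Matrix (Fin n) (Fin n) K) * t = 1 := by
      rw [← Units.val_mul, inv_mul_cancel, Units.val_one]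
    have h2 : v i = (c⁻¹ : Kˣ) • ((t : Matrix (Fin n) (Fin n) K) *ᵥ v i) := by
      rw [hc]; exact (inv_smul_smul c (v i)).symm
    conv_lhs => rw [h2]
    rw [Units.smul_def, Matrix.mulVec_smul, Matrix.mulVec_mulVec, h1, Matrix.one_mulVec]

theorem mem_frameStabilizer {v : Fin n → Fin n → K} {t : GL (Fin n) K} :
    t ∈ frameStabilizer v ↔
      ∀ i, ∃ c : Kˣ, (t : Matrix (Fin n) (Fin n) K) *ᵥ v i = (c : K) • v i := Iff.rfl

theorem mulVec_ne_zero (t : GL (Fin n) K) {v : Fin n → K} (hv : v ≠ 0) :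
    (t : Matrix (Fin n) (Fin n) K) *ᵥ v ≠ 0 := fun h => hv <| by
  have h1 : ((t⁻¹ : GL (Fin n) K) : Matrix (Fin n) (Fin n) K) * t = 1 := by
    rw [← Units.val_mul, inv_mul_cancel, Units.val_one]
  rw [← Matrix.one_mulVec v, ← h1, ← Matrix.mulVec_mulVec, h, Matrix.mulVec_zero]

theorem exists_unit_of_mulVec_eq_smul {t : GL (Fin n) K} {v : Fin n → K} (hv : v ≠ 0) {c : K}
    (h : (t : Matrix (Fin n) (Fin n) K) *ᵥ v = c • v) :
    ∃ c : Kˣ, (t : Matrix (Fin n) (Fin n) K) *ᵥ v = (c : K) • v := by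
  refine ⟨Units.mk0 c ?_, h⟩
  rintro rfl
  exact mulVec_ne_zero t hv (by rw [h, zero_smul])

theorem exists_frame_matrix {v : Fin n → Fin n → K} (hv : LinearIndependent K v) :
    ∃ g : GL (Fin n) K, ∀ i, (g : Matrix (Fin n) (Fin n) K) *ᵥ Pi.single i 1 = v i := by
  have h : IsUnit (Matrix.of v)ᵀ := Matrix.linearIndependent_cols_iff_isUnit.1 hv
  obtain ⟨g, hg⟩ := h
  refine ⟨g, fun i => ?_⟩
  rw [hg, Matrix.mulVec_single_one]
  rfl

theorem exists_eigenvalues {v : Fin n → Fin n → K} (hv : LinearIndependent K v)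
    (c : Fin n → Kˣ) : ∃ t : GL (Fin n) K,
      ∀ i, (t : Matrix (Fin n) (Fin n) K) *ᵥ v i = (c i : K) • v i := by
  obtain ⟨g, hg⟩ := exists_frame_matrix hv
  let d : GL (Fin n) K := ⟨Matrix.diagonal fun i => (c i : K),
    Matrix.diagonal fun i => ((c i)⁻¹ : Kˣ),
    by rw [Matrix.diagonal_mul_diagonal]; simp, by rw [Matrix.diagonal_mul_diagonal]; simp⟩
  refine ⟨g * d * g⁻¹, fun i => ?_⟩
  rw [← hg i, Matrix.mulVec_mulVec, ← Units.val_mul, inv_mul_cancel_right, Units.val_mul,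
    ← Matrix.mulVec_mulVec]
  have : (d : Matrix (Fin n) (Fin n) K) *ᵥ Pi.single i 1 = (c i : K) • Pi.single i 1 := by
    change Matrix.diagonal (fun i => (c i : K)) *ᵥ Pi.single i 1 = _
    rw [Matrix.diagonal_mulVec_single]
    ext j
    simp [Pi.single_apply]
  rw [this, Matrix.mulVec_smul]

theorem exists_eq_smul_of_eigenvector {v : Fin n → Fin n → K} (hv : LinearIndependent K v)
    {c : Fin n → Kˣ} (hc : Function.Injective c) {t : Matrix (Fin n) (Fin n) K}
    (ht : ∀ i, t *ᵥ v i = (c i : K) • v i) {u : Fin n → K} (hu : u ≠ 0) {b : K}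
    (htu : t *ᵥ u = b • u) : ∃ i, ∃ a : Kˣ, u = (a : K) • v i := by
  have hspan : Submodule.span K (Set.range v) = ⊤ :=
    hv.span_eq_top_of_card_eq_finrank' (by simp)
  obtain ⟨a, ha⟩ := (Submodule.mem_span_range_iff_exists_fun K).1
    (hspan ▸ Submodule.mem_top : u ∈ Submodule.span K (Set.range v))
  have h0 : ∑ i, (a i * ((c i : K) - b)) • v i = 0 := by
    have : t *ᵥ u = ∑ i, (a i * c i) • v i := by
      rw [← ha, Matrix.mulVec_sum]
      exact Finset.sum_congr rfl fun i _ => by rw [Matrix.mulVec_smul, ht, smul_smul]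
    simp_rw [mul_sub, sub_smul]
    rw [Finset.sum_sub_distrib, ← this, htu, ← ha, Finset.smul_sum, sub_eq_zero]
    exact Finset.sum_congr rfl fun i _ => by rw [smul_smul, mul_comm]
  have h1 := Fintype.linearIndependent_iff.1 hv _ h0
  obtain ⟨i, hi⟩ : ∃ i, a i ≠ 0 := by
    by_contra! h
    exact hu (by rw [← ha]; simp [h])
  have hb : (c i : K) = b := sub_eq_zero.1 ((mul_eq_zero.1 (h1 i)).resolve_left hi)
  refine ⟨i, Units.mk0 _ hi, ?_⟩
  rw [← ha, Finset.sum_eq_single i]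
  · rfl
  · intro j _ hj
    rw [(mul_eq_zero.1 (h1 j)).resolve_right, zero_smul]
    rw [← hb, sub_eq_zero]
    exact fun h => hj (hc (Units.ext h))
  · simp

/-- An infinite field has `n` distinct nonzero eigenvalues to prescribe; an element with these
eigenvalues recovers the lines of the frame from the group. -/
theorem exists_regular_element [Infinite K] {v : Fin n → Fin n → K} (hv : LinearIndependent K v) :
    ∃ t ∈ frameStabilizer v, ∀ (u : Fin n → K) (b : K), u ≠ 0 →
      (t : Matrix (Fin n) (Fin n) K) *ᵥ u = b • u → ∃ i, ∃ a : Kˣ, u = (a : K) • v i := by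
  have hinf : Infinite {x : K // x ≠ 0} := (Set.finite_singleton (0 : K)).infinite_compl.to_subtype
  let f := Infinite.natEmbedding {x : K // x ≠ 0}
  let c : Fin n → Kˣ := fun i => Units.mk0 (f i) (f i).2
  have hc : Function.Injective c := fun i j h =>
    Fin.ext (f.injective (Subtype.ext (Units.ext_iff.1 h)))
  obtain ⟨t, ht⟩ := exists_eigenvalues hv c
  exact ⟨t, fun i => ⟨c i, ht i⟩, fun u b hu h => exists_eq_smul_of_eigenvector hv hc ht hu h⟩

/-- Each `v i` is an eigenvector of a regular element for `u`, hence a multiple of some `u j`. So a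
frame is determined by its stabilizer up to permutation and scaling, which gives both maximality and
the fibres over a torus. -/
theorem exists_perm_of_frameStabilizer_le [Infinite K] {u v : Fin n → Fin n → K}
    (hu : LinearIndependent K u) (hv : LinearIndependent K v)
    (h : frameStabilizer u ≤ frameStabilizer v) :
    ∃ (s : Equiv.Perm (Fin n)) (a : Fin n → Kˣ), ∀ i, v i = (a i : K) • u (s i) := by
  obtain ⟨t, ht, hreg⟩ := exists_regular_element hu
  have h1 (i : Fin n) : ∃ j, ∃ a : Kˣ, v i = (a : K) • u j := by
    obtain ⟨c, hc⟩ := h ht i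
    exact hreg _ _ (hv.ne_zero i) hc
  choose s a hs using h1
  have hinj : Function.Injective s := by
    intro i j hij
    have h2 : v i = ((a i * (a j)⁻¹ : Kˣ) : K) • v j := by
      rw [hs i, hs j, hij, smul_smul, ← Units.val_mul, inv_mul_cancel_right]
    exact hv.eq_of_smul_apply_eq_smul_apply 1 _ i j one_ne_zero (by rw [one_smul, h2])
  exact ⟨Equiv.ofBijective s (Finite.injective_iff_bijective.1 hinj), a, hs⟩

theorem frameStabilizer_smul (u : Fin n → Fin n → K) (s : Equiv.Perm (Fin n)) (a : Fin n → Kˣ) :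
    frameStabilizer (fun i => (a i : K) • u (s i)) = frameStabilizer u := by
  have key (a : Kˣ) (w : Fin n → K) (t : Matrix (Fin n) (Fin n) K) (c : Kˣ) :
      t *ᵥ ((a : K) • w) = (c : K) • (a : K) • w ↔ t *ᵥ w = (c : K) • w := by
    rw [Matrix.mulVec_smul, smul_comm (c : K)]
    exact (MulAction.injective a).eq_iff
  ext t
  rw [mem_frameStabilizer, mem_frameStabilizer, ← s.forall_congr_right (q := fun i =>
    ∃ c : Kˣ, (t : Matrix (Fin n) (Fin n) K) *ᵥ u i = (c : K) • u i)]
  simp only [key]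

theorem linearIndependent_smul_perm {u : Fin n → Fin n → K} (hu : LinearIndependent K u)
    (s : Equiv.Perm (Fin n)) (a : Fin n → Kˣ) :
    LinearIndependent K (fun i => (a i : K) • u (s i)) :=
  (hu.comp s s.injective).units_smul a

theorem isDiagonalizableSubgroup_iff (T : Subgroup (GL (Fin n) K)) :
    IsDiagonalizableSubgroup T ↔ ∃ v, LinearIndependent K v ∧ T ≤ frameStabilizer v := by
  constructor
  · rintro ⟨g, hg⟩
    have hli : LinearIndependent K ((g⁻¹ : GL (Fin n) K) : Matrix (Fin n) (Fin n) K).col :=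
      Matrix.linearIndependent_cols_iff_isUnit.2 (Units.isUnit _)
    refine ⟨_, hli, fun t ht i => exists_unit_of_mulVec_eq_smul (hli.ne_zero i)
      (c := ((g * t * g⁻¹ : GL (Fin n) K) : Matrix (Fin n) (Fin n) K) i i) ?_⟩
    rw [← Matrix.mulVec_single_one, Matrix.mulVec_mulVec]
    have h1 : (t : Matrix (Fin n) (Fin n) K) * ((g⁻¹ : GL (Fin n) K) : Matrix (Fin n) (Fin n) K) =
        ((g⁻¹ : GL (Fin n) K) : Matrix (Fin n) (Fin n) K) *
          ((g * t * g⁻¹ : GL (Fin n) K) : Matrix (Fin n) (Fin n) K) := by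
      rw [← Units.val_mul, ← Units.val_mul]
      congr 1
      group
    rw [h1, ← Matrix.mulVec_mulVec, ← Matrix.mulVec_smul]
    congr 1
    rw [Matrix.mulVec_single_one]
    ext j
    by_cases hij : j = i
    · subst hij; simp
    · have h0 : ((g * t * g⁻¹ : GL (Fin n) K) : Matrix (Fin n) (Fin n) K) j i = 0 := hg t ht hij
      simpa [hij] using h0
  · rintro ⟨v, hv, hT⟩
    obtain ⟨g, hg⟩ := exists_frame_matrix hv
    refine ⟨g⁻¹, fun t ht i j hij => ?_⟩
    obtain ⟨c, hc⟩ := hT ht j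
    have h1 : ((g⁻¹ * t * g⁻¹⁻¹ : GL (Fin n) K) : Matrix (Fin n) (Fin n) K) *ᵥ Pi.single j 1 =
        (c : K) • Pi.single j 1 := by
      rw [inv_inv, Units.val_mul, ← Matrix.mulVec_mulVec, hg, Units.val_mul,
        ← Matrix.mulVec_mulVec, hc, Matrix.mulVec_smul, ← hg j, Matrix.mulVec_mulVec,
        ← Units.val_mul, inv_mul_cancel, Units.val_one, Matrix.one_mulVec]
    rw [Matrix.mulVec_single_one] at h1
    have := congrFun h1 i
    simpa [hij] using this

theorem isDiagonalizableSubgroup_frameStabilizer {v : Fin n → Fin n → K}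
    (hv : LinearIndependent K v) : IsDiagonalizableSubgroup (frameStabilizer v) :=
  (isDiagonalizableSubgroup_iff _).2 ⟨v, hv, le_rfl⟩

theorem maximal_frameStabilizer [Infinite K] {v : Fin n → Fin n → K}
    (hv : LinearIndependent K v) : Maximal IsDiagonalizableSubgroup (frameStabilizer v) := by
  refine ⟨isDiagonalizableSubgroup_frameStabilizer hv, fun S hS hle => ?_⟩
  obtain ⟨u, hu, hSu⟩ := (isDiagonalizableSubgroup_iff S).1 hS
  obtain ⟨s, a, hsa⟩ := exists_perm_of_frameStabilizer_le hv hu (hle.trans hSu)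
  rw [funext hsa, frameStabilizer_smul] at hSu
  exact hSu

theorem exists_eq_frameStabilizer_of_maximal {T : Subgroup (GL (Fin n) K)}
    (hT : Maximal IsDiagonalizableSubgroup T) :
    ∃ v, LinearIndependent K v ∧ T = frameStabilizer v := by
  obtain ⟨v, hv, hle⟩ := (isDiagonalizableSubgroup_iff T).1 hT.1
  exact ⟨v, hv, le_antisymm hle (hT.2 (isDiagonalizableSubgroup_frameStabilizer hv) hle)⟩

theorem map_frameStabilizer_le (v : Fin n → Fin n → K) (τ : K →+* K) :
    (frameStabilizer v).map (Matrix.GeneralLinearGroup.map τ) ≤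
      frameStabilizer (fun i j => τ (v i j)) := by
  rintro _ ⟨t, ht, rfl⟩ i
  obtain ⟨c, hc⟩ := ht i
  refine ⟨Units.map τ.toMonoidHom c, funext fun j => ?_⟩
  have := congrArg τ (congrFun hc j)
  simpa [Matrix.mulVec, dotProduct, map_sum] using this

end frames

end

noncomputable section

/-! ## Maximal tori over a finite field -/

theorem cycleSizes_congr {α β : Type*} [Finite α] [Finite β] (e : α ≃ β) (w : Equiv.Perm α)
    (w' : Equiv.Perm β) (h : ∀ a, e (w a) = w' (e a)) : cycleSizes w = cycleSizes w' := by
  classical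
  have hw' : w' = e.permCongrHom w := by
    ext b
    obtain ⟨a, rfl⟩ := e.surjective b
    simp [← h]
  have hs (a b : α) : w.SameCycle a b ↔ w'.SameCycle (e a) (e b) := by
    refine exists_congr fun k => ?_
    rw [hw', ← map_zpow]
    simp
  let f : PermCycle w ≃ PermCycle w' := Quotient.congr e hs
  have hf (a : α) : f (cycleAt w a) = cycleAt w' (e a) := rfl
  have hsize (c : PermCycle w) : (f c).size = c.size := by
    refine (Nat.card_congr (e.subtypeEquiv fun a => ?_)).symm
    change cycleAt w a = c ↔ cycleAt w' (e a) = f c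
    rw [← hf, f.apply_eq_iff_eq]
  rw [cycleSizes, cycleSizes, ← Multiset.map_univ_val_equiv f, Multiset.map_map]
  exact Multiset.map_congr rfl fun c _ => (hsize c).symm

theorem mk_mem_eigenlines_iff {k : Type*} [Field k] {n : ℕ} {T : MaximalTorus k n}
    {u : Fin n → Fin n → AlgebraicClosure k}
    (hu : LinearIndependent (AlgebraicClosure k) u) (hT : T.points = frameStabilizer u)
    (L : ℙ (AlgebraicClosure k) (Fin n → AlgebraicClosure k)) :
    L ∈ T.eigenlines ↔ ∃ i, Projectivization.mk (AlgebraicClosure k) (u i) (hu.ne_zero i) = L := by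
  constructor
  · intro h
    induction L using Projectivization.ind with
    | h v hv =>
      obtain ⟨t, ht, hreg⟩ := exists_regular_element hu
      have h1 := h t (hT ▸ ht) v (by
        rw [Projectivization.submodule_mk]; exact Submodule.mem_span_singleton_self v)
      rw [Projectivization.submodule_mk, Submodule.mem_span_singleton] at h1
      obtain ⟨b, hb⟩ := h1
      obtain ⟨i, a, ha⟩ := hreg v b hv hb.symm
      refine ⟨i, ((Projectivization.mk_eq_mk_iff (AlgebraicClosure k) _ _ _ _).2 ⟨a, ?_⟩).symm⟩
      rw [ha]; rfl
  · rintro ⟨i, rfl⟩ t ht v hv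
    rw [Projectivization.submodule_mk, Submodule.mem_span_singleton] at hv ⊢
    obtain ⟨b, rfl⟩ := hv
    rw [hT] at ht
    obtain ⟨c, hc⟩ := ht i
    exact ⟨b * c, by rw [Matrix.mulVec_smul, hc, smul_smul]⟩

theorem mk_injective {K : Type*} [Field K] {n : ℕ} {u : Fin n → Fin n → K} (hu : LinearIndependent K u) :
    Function.Injective fun i => Projectivization.mk K (u i) (hu.ne_zero i) := by
  intro i j h
  obtain ⟨a, ha⟩ := (Projectivization.mk_eq_mk_iff K _ _ _ _).1 h
  exact hu.eq_of_smul_apply_eq_smul_apply 1 (a : K) i j one_ne_zero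
    (by rw [one_smul, ← ha]; rfl)

section galois

variable {F : Type*} [Field F] [Fintype F]

local notation "q" => Fintype.card F
local notation "K" => AlgebraicClosure F

/-- A finite set generates a finite extension, whose Galois group consists of powers of Frobenius.
Thus stability under the whole Galois group reduces to Frobenius. -/
theorem exists_forall_galois_eq_pow {S : Set K} (hS : S.Finite) (τ : K ≃ₐ[F] K) :
    ∃ r : ℕ, ∀ x ∈ S, τ x = x ^ q ^ r := by
  let E := IntermediateField.adjoin F S
  have := hS.to_subtype
  have : FiniteDimensional F E := IntermediateField.finiteDimensional_adjoin fun x _ =>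
    (Algebra.IsAlgebraic.isAlgebraic x).isIntegral
  have : Finite E := Module.finite_of_finite F
  obtain ⟨r, hr⟩ := (FiniteField.bijective_frobeniusAlgEquivOfAlgebraic_pow F E).2
    (τ.restrictNormal E)
  refine ⟨r, fun x hx => ?_⟩
  have h1 := τ.restrictNormal_commutes E ⟨x, IntermediateField.subset_adjoin F S hx⟩
  rw [← hr] at h1
  simp only [AlgEquiv.coe_pow, FiniteField.coe_frobeniusAlgEquivOfAlgebraic_iterate] at h1
  exact h1.symm

variable {n : ℕ}

/-- The bases of `K^n` permuted by the Frobenius map, together with the permutation. -/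
abbrev FrobeniusBasis (F : Type*) [Field F] [Fintype F] (n : ℕ) : Type _ :=
  Σ w : Equiv.Perm (Fin n), {v : Fin n → Fin n → AlgebraicClosure F //
    LinearIndependent (AlgebraicClosure F) v ∧ ∀ i j, v (w i) j = v i j ^ Fintype.card F}

theorem frobenius_iterate {w : Equiv.Perm (Fin n)} {v : Fin n → Fin n → K}
    (hv : ∀ i j, v (w i) j = v i j ^ q) (r : ℕ) (i j : Fin n) :
    v ((w ^ r) i) j = v i j ^ q ^ r := by
  induction r with
  | zero => simp
  | succ r ih => rw [pow_succ', Equiv.Perm.mul_apply, hv, ih, ← pow_mul, ← pow_succ]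

theorem map_frameStabilizer_le_self {w : Equiv.Perm (Fin n)} {v : Fin n → Fin n → K}
    (hv : ∀ i j, v (w i) j = v i j ^ q) (τ : K ≃ₐ[F] K) :
    (frameStabilizer v).map (Matrix.GeneralLinearGroup.map (τ : K →+* K)) ≤ frameStabilizer v := by
  obtain ⟨r, hr⟩ := exists_forall_galois_eq_pow
    (S := Set.range fun p : Fin n × Fin n => v p.1 p.2) (Set.finite_range _) τ
  refine (map_frameStabilizer_le v _).trans (le_of_eq ?_)
  have h1 := frameStabilizer_smul v (w ^ r) 1
  rw [← h1]
  congr 1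
  funext i j
  rw [Pi.smul_apply, Pi.one_apply, Units.val_one, one_smul, frobenius_iterate hv]
  exact hr _ ⟨(i, j), rfl⟩

/-- The maximal torus with the given Frobenius-stable basis of eigenvectors. -/
def torusOfBasis (b : FrobeniusBasis F n) : MaximalTorus F n where
  points := frameStabilizer b.2.1
  isMaximal := maximal_frameStabilizer b.2.2.1
  isDefined τ := by
    refine le_antisymm (map_frameStabilizer_le_self b.2.2.2 τ) fun t ht => ?_
    refine ⟨Matrix.GeneralLinearGroup.map (τ.symm : K →+* K) t,
      map_frameStabilizer_le_self b.2.2.2 τ.symm ⟨t, ht, rfl⟩, ?_⟩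
    ext i j
    simp

/-- A basis of eigenvectors of a maximal torus enumerates its eigenlines. -/
def eigenlineEquiv {T : MaximalTorus F n} {u : Fin n → Fin n → K}
    (hu : LinearIndependent K u) (hT : T.points = frameStabilizer u) : Fin n ≃ T.eigenlines :=
  Equiv.ofBijective
    (fun i => ⟨Projectivization.mk K (u i) (hu.ne_zero i), (mk_mem_eigenlines_iff hu hT _).2 ⟨i, rfl⟩⟩)
    ⟨fun _ _ h => mk_injective hu (Subtype.ext_iff.1 h), fun L => by
      obtain ⟨i, hi⟩ := (mk_mem_eigenlines_iff hu hT L.1).1 L.2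
      exact ⟨i, Subtype.ext hi⟩⟩

/-- `π` is the Frobenius permutation of eigenlines read on indices; the scalars `μ` arise because
Frobenius respects lines but not the chosen vectors. -/
theorem exists_frobenius_scalars {T : MaximalTorus F n} {u : Fin n → Fin n → K}
    (hu : LinearIndependent K u) (hT : T.points = frameStabilizer u) :
    ∃ (π : Equiv.Perm (Fin n)) (μ : Fin n → Kˣ),
      (∀ i j, u i j ^ q = μ i * u (π i) j) ∧
      ∀ P : CharacterPolynomial, P.evalTorus T = P.evalPerm π := by
  let e := eigenlineEquiv hu hT
  let π : Equiv.Perm (Fin n) := (e.trans T.frobeniusPerm).trans e.symm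
  have he (i : Fin n) : e (π i) = T.frobeniusPerm (e i) := e.apply_symm_apply _
  have h1 (i : Fin n) : ∃ a : Kˣ, ∀ j, u i j ^ q = a * u (π i) j := by
    have h2 : lineAct n (FiniteField.frobeniusAlgEquivOfAlgebraic F K)
        (Projectivization.mk K (u i) (hu.ne_zero i)) =
          Projectivization.mk K (u (π i)) (hu.ne_zero _) :=
      (congrArg Subtype.val (he i)).symm
    obtain ⟨a, ha⟩ := (Projectivization.mk_eq_mk_iff K _ _ _ _).1 h2
    exact ⟨a, fun j => (congrFun ha j).symm⟩
  choose μ hμ using h1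
  refine ⟨π, μ, hμ, fun P => ?_⟩
  have : Finite T.eigenlines := Finite.of_equiv _ e
  rw [CharacterPolynomial.evalTorus, CharacterPolynomial.evalPerm_eq_evalCounts,
    CharacterPolynomial.evalPerm_eq_evalCounts, cycleSizes_congr e π _ he]

/-- The Frobenius-stable bases of eigenvectors of a maximal torus, in terms of an arbitrary basis of
eigenvectors. -/
theorem exists_fiber_equiv {T : MaximalTorus F n} {u : Fin n → Fin n → K}
    (hu : LinearIndependent K u) (hT : T.points = frameStabilizer u)
    {π : Equiv.Perm (Fin n)} {μ : Fin n → Kˣ} (hμ : ∀ i j, u i j ^ q = μ i * u (π i) j) :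
    ∃ f : (Σ s : Equiv.Perm (Fin n),
        {a : Fin n → Kˣ // ∀ i, a ((s⁻¹ * π * s) i) = μ (s i) * a i ^ q}) ≃
        {b : FrobeniusBasis F n // torusOfBasis b = T},
      ∀ x, (f x).1.1 = x.1⁻¹ * π * x.1 := by
  -- Independence of `u` lets one compare first the indices, which gives `w = s⁻¹ * π * s`, and then
  -- the scalars, which gives the equation on `a`.
  have hv (s : Equiv.Perm (Fin n)) (a : Fin n → Kˣ) (w : Equiv.Perm (Fin n)) :
      (∀ i j, ((a (w i) : K) • u (s (w i))) j = (((a i : K) • u (s i)) j) ^ q) ↔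
        w = s⁻¹ * π * s ∧ ∀ i, a (w i) = μ (s i) * a i ^ q := by
    have h1 (i : Fin n) : (∀ j, ((a (w i) : K) • u (s (w i))) j = (((a i : K) • u (s i)) j) ^ q) ↔
        (a (w i) : K) • u (s (w i)) = ((μ (s i) * a i ^ q : Kˣ) : K) • u (π (s i)) := by
      rw [funext_iff]
      refine forall_congr' fun j => ?_
      simp only [Pi.smul_apply, smul_eq_mul, mul_pow, hμ, Units.val_mul, Units.val_pow_eq_pow_val]
      rw [← mul_assoc, mul_comm ((a i : K) ^ q)]
    simp only [h1]
    constructor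
    · intro h
      have h2 (i : Fin n) : s (w i) = π (s i) :=
        hu.eq_of_smul_apply_eq_smul_apply _ _ _ _ (Units.ne_zero _) (h i)
      refine ⟨Equiv.ext fun i => ?_, fun i => ?_⟩
      · rw [Equiv.Perm.mul_apply, Equiv.Perm.mul_apply, ← h2]
        simp
      · have h3 := h i
        rw [h2] at h3
        exact Units.ext (smul_left_injective K (hu.ne_zero _) h3)
    · rintro ⟨hw, h⟩ i
      rw [h]
      congr 2
      rw [hw]
      simp
  let g (x : Σ s : Equiv.Perm (Fin n),
      {a : Fin n → Kˣ // ∀ i, a ((s⁻¹ * π * s) i) = μ (s i) * a i ^ q}) :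
      {b : FrobeniusBasis F n // torusOfBasis b = T} :=
    ⟨⟨x.1⁻¹ * π * x.1, fun i => (x.2.1 i : K) • u (x.1 i),
      linearIndependent_smul_perm hu x.1 x.2.1, (hv _ _ _).2 ⟨rfl, x.2.2⟩⟩,
      MaximalTorus.ext (by rw [hT]; exact frameStabilizer_smul u x.1 x.2.1)⟩
  refine ⟨Equiv.ofBijective g ⟨?_, ?_⟩, fun x => rfl⟩
  · rintro ⟨s, a, ha⟩ ⟨s', a', ha'⟩ h
    have h1 : (fun i => (a i : K) • u (s i)) = fun i => (a' i : K) • u (s' i) :=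
      congrArg (fun b : {b : FrobeniusBasis F n // torusOfBasis b = T} => b.1.2.1) h
    have hs : s = s' := Equiv.ext fun i =>
      hu.eq_of_smul_apply_eq_smul_apply _ _ _ _ (Units.ne_zero _) (congrFun h1 i)
    subst hs
    have : a = a' := funext fun i =>
      Units.ext (smul_left_injective K (hu.ne_zero _) (congrFun h1 i))
    subst this
    rfl
  · rintro ⟨⟨w, v, hvli, hvf⟩, hb⟩
    have hpts : frameStabilizer v = frameStabilizer u := by
      rw [← hT, ← hb]; rfl
    obtain ⟨s, a, hsa⟩ := exists_perm_of_frameStabilizer_le hu hvli hpts.ge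
    obtain rfl : v = fun i => (a i : K) • u (s i) := funext hsa
    obtain ⟨rfl, ha⟩ := (hv s a w).1 hvf
    exact ⟨⟨s, a, ha⟩, rfl⟩

theorem cycleSizes_conj (π s : Equiv.Perm (Fin n)) : cycleSizes (s⁻¹ * π * s) = cycleSizes π :=
  cycleSizes_congr s _ _ fun a => by simp

instance finite_frobeniusBasis : Finite (FrobeniusBasis F n) := by
  have (w : Equiv.Perm (Fin n)) : Finite {v : Fin n → Fin n → K //
      LinearIndependent K v ∧ ∀ i j, v (w i) j = v i j ^ q} := by
    refine Nat.finite_of_card_ne_zero ?_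
    rw [card_frobenius_bases F K w, Finset.prod_ne_zero_iff]
    intro i _
    exact Nat.sub_ne_zero_of_lt (Nat.pow_lt_pow_right Fintype.one_lt_card i.2)
  infer_instance

/-- A form of Hilbert 90: the rescalings of an eigenbasis that Frobenius permutes number ∏ (q^d -
1), which is nonzero. -/
theorem torusOfBasis_surjective : Function.Surjective (torusOfBasis (F := F) (n := n)) := by
  intro T
  obtain ⟨u, hu, hT⟩ := exists_eq_frameStabilizer_of_maximal T.isMaximal
  obtain ⟨π, μ, hμ, -⟩ := exists_frobenius_scalars hu hT
  obtain ⟨f, -⟩ := exists_fiber_equiv hu hT hμ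
  have hcard := card_frobenius_fixed_units F (1⁻¹ * π * 1) fun i => μ ((1 : Equiv.Perm (Fin n)) i)
  have hne : Nat.card {a : Fin n → Kˣ //
      ∀ i, a ((1⁻¹ * π * 1 : Equiv.Perm (Fin n)) i) = μ ((1 : Equiv.Perm (Fin n)) i) * a i ^ q} ≠ 0 := by
    rw [hcard, Finset.prod_ne_zero_iff]
    intro c _
    exact Nat.sub_ne_zero_of_lt (one_lt_card_pow c.size_pos)
  obtain ⟨a⟩ := (Nat.card_ne_zero.1 hne).1
  exact ⟨(f ⟨1, a⟩).1, (f ⟨1, a⟩).2⟩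

instance finite_maximalTorus : Finite (MaximalTorus F n) :=
  Finite.of_surjective _ torusOfBasis_surjective

/-- The sum of a character polynomial over the maximal tori of `GL_n` over a finite field. -/
theorem sum_evalTorus (P : CharacterPolynomial) :
    (n.factorial : ℚ) * ∑ᶠ T : MaximalTorus F n, P.evalTorus T =
      ∑ w : Equiv.Perm (Fin n), P.evalPerm w *
        ((∏ i : Fin n, (q ^ n - q ^ (i : ℕ)) : ℕ) : ℚ) *
          ((cycleSizes w).map fun k => ((q ^ k - 1 : ℕ) : ℚ)⁻¹).prod := by
  classical
  have : Fintype (MaximalTorus F n) := Fintype.ofFinite _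
  have : Fintype (FrobeniusBasis F n) := Fintype.ofFinite _
  -- The weight is chosen so that each fibre of `torusOfBasis` has total n! P(T): there are n!
  -- choices of `s`, all giving conjugates of `π`, and ∏ (q^d - 1) scalings for each.
  let h (w : Equiv.Perm (Fin n)) : ℚ := P.evalPerm w *
    ((cycleSizes w).map fun k => ((q ^ k - 1 : ℕ) : ℚ)⁻¹).prod
  have hfib (T : MaximalTorus F n) : ∑ b : {b : FrobeniusBasis F n // torusOfBasis b = T}, h b.1.1 =
      n.factorial * P.evalTorus T := by
    obtain ⟨u, hu, hT⟩ := exists_eq_frameStabilizer_of_maximal T.isMaximal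
    obtain ⟨π, μ, hμ, hP⟩ := exists_frobenius_scalars hu hT
    obtain ⟨f, hf⟩ := exists_fiber_equiv hu hT hμ
    have : Finite (Σ s : Equiv.Perm (Fin n),
        {a : Fin n → Kˣ // ∀ i, a ((s⁻¹ * π * s) i) = μ (s i) * a i ^ q}) := Finite.of_equiv _ f.symm
    have (s : Equiv.Perm (Fin n)) : Fintype
        {a : Fin n → Kˣ // ∀ i, a ((s⁻¹ * π * s) i) = μ (s i) * a i ^ q} :=
      have := Finite.of_injective _ (sigma_mk_injective (i := s) (β := fun s : Equiv.Perm (Fin n) =>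
        {a : Fin n → Kˣ // ∀ i, a ((s⁻¹ * π * s) i) = μ (s i) * a i ^ q}))
      Fintype.ofFinite _
    rw [← Equiv.sum_comp f, Fintype.sum_sigma]
    simp only [hf]
    have hone (s : Equiv.Perm (Fin n)) : ∑ _a : {a : Fin n → Kˣ //
        ∀ i, a ((s⁻¹ * π * s) i) = μ (s i) * a i ^ q}, h (s⁻¹ * π * s) = P.evalTorus T := by
      rw [Finset.sum_const, Finset.card_univ, ← Nat.card_eq_fintype_card,
        card_frobenius_fixed_units F (s⁻¹ * π * s) fun i => μ (s i),
        ← prod_map_cycleSizes _ fun k => q ^ k - 1, cycleSizes_conj]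
      simp only [h, cycleSizes_conj, CharacterPolynomial.evalPerm_eq_evalCounts]
      rw [hP, CharacterPolynomial.evalPerm_eq_evalCounts, nsmul_eq_mul, mul_left_comm,
        prod_map_cycleSizes, prod_map_cycleSizes, Nat.cast_prod, ← Finset.prod_mul_distrib,
        Finset.prod_congr rfl fun c _ => mul_inv_cancel₀ (Nat.cast_ne_zero.2
          (Nat.sub_ne_zero_of_lt (one_lt_card_pow c.size_pos))), Finset.prod_const_one, mul_one]
    rw [Finset.sum_congr rfl fun s _ => hone s, Finset.sum_const, Finset.card_univ,
      Fintype.card_perm, Fintype.card_fin, nsmul_eq_mul]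
  rw [finsum_eq_sum_of_fintype, Finset.mul_sum, Finset.sum_congr rfl fun T _ => (hfib T).symm,
    Fintype.sum_fiberwise (torusOfBasis (F := F) (n := n)) fun b => h b.1]
  have (w : Equiv.Perm (Fin n)) : Fintype {v : Fin n → Fin n → K //
      LinearIndependent K v ∧ ∀ i j, v (w i) j = v i j ^ q} :=
    have := Finite.of_injective _ (sigma_mk_injective (i := w) (β := fun w : Equiv.Perm (Fin n) =>
      {v : Fin n → Fin n → K // LinearIndependent K v ∧ ∀ i j, v (w i) j = v i j ^ q}))
    Fintype.ofFinite _
  have hsig := Fintype.sum_sigma fun b : FrobeniusBasis F n => h b.1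
  refine Eq.trans (by convert hsig) (Finset.sum_congr rfl fun w _ => ?_)
  dsimp only
  rw [Finset.sum_const, Finset.card_univ, ← Nat.card_eq_fintype_card, card_frobenius_bases F K w,
    nsmul_eq_mul, mul_left_comm, mul_assoc]

end galois

end

noncomputable section

/-! ## The main theorem -/

theorem prod_map_inv_pow_sub_one {q : ℕ} (hq : 0 < q) (m : Multiset ℕ) :
    (m.map fun k => ((q ^ k - 1 : ℕ) : ℝ)⁻¹).prod =
      (q : ℝ)⁻¹ ^ m.sum * (m.map fun k => (1 - (q : ℝ)⁻¹ ^ k)⁻¹).prod := by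
  have hq' : (q : ℝ) ≠ 0 := by exact_mod_cast hq.ne'
  have h (k : ℕ) : ((q ^ k - 1 : ℕ) : ℝ)⁻¹ = (q : ℝ)⁻¹ ^ k * (1 - (q : ℝ)⁻¹ ^ k)⁻¹ := by
    rw [Nat.cast_sub (Nat.one_le_pow _ _ hq), Nat.cast_pow, Nat.cast_one, inv_pow, ← mul_inv,
      mul_sub, mul_one, mul_inv_cancel₀ (pow_ne_zero _ hq')]
  simp_rw [h]
  rw [Multiset.prod_map_mul]
  congr 1
  induction m using Multiset.induction_on with
  | empty => simp
  | cons a s ih => rw [Multiset.map_cons, Multiset.prod_cons, ih, Multiset.sum_cons, pow_add]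

theorem prod_pow_sub_pow {q : ℕ} (hq : 0 < q) (n : ℕ) :
    ((∏ i : Fin n, (q ^ n - q ^ (i : ℕ)) : ℕ) : ℝ) =
      (q : ℝ) ^ n ^ 2 * ∏ i ∈ Finset.range n, (1 - (q : ℝ)⁻¹ ^ (i + 1)) := by
  have hq' : (q : ℝ) ≠ 0 := by exact_mod_cast hq.ne'
  rw [Fin.prod_univ_eq_prod_range (fun i => q ^ n - q ^ i), ← Finset.prod_range_reflect, pow_two,
    pow_mul, Nat.cast_prod]
  conv_rhs => rw [← Finset.card_range n, Finset.card_range, ← Finset.card_range n]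
  rw [← Finset.prod_const, Finset.card_range, ← Finset.prod_mul_distrib]
  refine Finset.prod_congr rfl fun i hi => ?_
  have hi' := Finset.mem_range.1 hi
  rw [Nat.cast_sub (Nat.pow_le_pow_right hq (by omega)), Nat.cast_pow, Nat.cast_pow, mul_sub,
    mul_one]
  congr 1
  obtain ⟨m, rfl⟩ := Nat.exists_eq_add_of_lt hi'
  rw [show i + m + 1 - 1 - i = m by omega, show i + m + 1 = m + (i + 1) by omega, pow_add,
    mul_assoc, ← mul_pow, mul_inv_cancel₀ hq', one_pow, mul_one]

/-- The order of GL_n contributes q^{n²}, and ∏ (q^d - 1)⁻¹ contributes q^{-n} since the cycle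
lengths sum to n; the normalization removes exactly q^{n²-n}. -/
theorem normalized_sum_evalTorus (P : CharacterPolynomial) {F : Type*} [Field F] [Fintype F]
    (n : ℕ) :
    ((Fintype.card F : ℝ) ^ (n ^ 2 - n))⁻¹ * ∑ᶠ T : MaximalTorus F n, ((P.evalTorus T : ℚ) : ℝ) =
      twistedMean (Fintype.card F : ℝ)⁻¹ (fun k => (1 - (Fintype.card F : ℝ)⁻¹ ^ k)⁻¹) P 0 n := by
  set q := Fintype.card F with hq
  have hq0 : 0 < q := Fintype.card_pos
  have hq' : (q : ℝ) ≠ 0 := by exact_mod_cast hq0.ne'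
  have : Fintype (MaximalTorus F n) := Fintype.ofFinite _
  let f (m : Multiset ℕ) : ℝ := ((P.evalCounts m : ℚ) : ℝ) *
    ((∏ i : Fin n, (q ^ n - q ^ (i : ℕ)) : ℕ) : ℝ) *
      (m.map fun k => ((q ^ k - 1 : ℕ) : ℝ)⁻¹).prod
  have h1 : (n.factorial : ℝ) * ∑ᶠ T : MaximalTorus F n, ((P.evalTorus T : ℚ) : ℝ) =
      ∑ w : Equiv.Perm (Fin n), f (cycleSizes w) := by
    have h := congrArg (fun a : ℚ => (a : ℝ)) (sum_evalTorus (F := F) (n := n) P)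
    rw [finsum_eq_sum_of_fintype] at h ⊢
    simp only [Rat.cast_mul, Rat.cast_sum, Rat.cast_natCast, prod_map_cycleSizes, Rat.cast_prod,
      Rat.cast_inv, CharacterPolynomial.evalPerm_eq_evalCounts] at h
    simp only [f, prod_map_cycleSizes]
    exact h
  rw [sum_perm_cycleSizes n f, Rat.smul_def, Rat.cast_natCast] at h1
  rw [mul_left_cancel₀ (by exact_mod_cast n.factorial_ne_zero) h1, twistedMean,
    partitionMean, Finset.mul_sum, Finset.mul_sum]
  refine Finset.sum_congr rfl fun l _ => ?_
  simp only [f]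
  rw [prod_map_inv_pow_sub_one hq0, prod_pow_sub_pow hq0, l.parts_sum, zero_add, Rat.smul_def, Rat.smul_def,
    Rat.smul_def]
  have h2 : ((q : ℝ) ^ (n ^ 2 - n))⁻¹ * (q : ℝ) ^ n ^ 2 * (q : ℝ)⁻¹ ^ n = 1 := by
    have h3 : n ^ 2 = (n ^ 2 - n) + n := by
      have : n ≤ n ^ 2 := Nat.le_self_pow two_ne_zero n
      omega
    conv_lhs => rw [h3, pow_add, Nat.add_sub_cancel]
    field_simp
    rw [← mul_pow, mul_one_div_cancel hq', one_pow]
  linear_combination (((centralizerOrder l.parts : ℚ)⁻¹ : ℚ) : ℝ) * ((P.evalCounts l.parts : ℚ) : ℝ) *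
    (∏ i ∈ Finset.range n, (1 - (q : ℝ)⁻¹ ^ (i + 1))) *
    (l.parts.map fun k => (1 - (q : ℝ)⁻¹ ^ k)⁻¹).prod * h2

end

theorem mainTheorem5 (P : CharacterPolynomial) (q : ℕ) (F : Type*) [Field F] [Fintype F]
    (hq : Fintype.card F = q) :
    (∀ i, ∀ᶠ n in Filter.atTop, coinvariantMultiplicity P n i = stableMultiplicity P i) ∧
    (∀ n, Finite (MaximalTorus F n)) ∧
    Summable (fun i : ℕ => (stableMultiplicity P i : ℝ) / (q : ℝ) ^ i) ∧
    Filter.Tendsto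
      (fun n : ℕ => ((q : ℝ) ^ (n ^ 2 - n))⁻¹ *
        ∑ᶠ T : MaximalTorus F n, ((P.evalTorus T : ℚ) : ℝ))
      Filter.atTop
      (nhds (∑' i : ℕ, (stableMultiplicity P i : ℝ) / (q : ℝ) ^ i)) := by
  subst hq
  have hx : ((Fintype.card F : ℝ))⁻¹ < 1 :=
    inv_lt_one_of_one_lt₀ (by exact_mod_cast Fintype.one_lt_card)
  obtain ⟨C, v, hC, hv, ht⟩ := exists_stable_twistedMean P (by positivity) hx 0
  have hlim (i : ℕ) : Filter.Tendsto (fun n => coinvariantMultiplicity P n i) Filter.atTop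
      (pure (PowerSeries.coeff i C)) := by
    simpa only [coinvariantMultiplicity_eq_coeff] using hC i
  -- Eventual constancy implies convergence in ℚ, so the `limUnder` is the genuine limit and not a
  -- default value.
  have hst (i : ℕ) : stableMultiplicity P i = PowerSeries.coeff i C :=
    ((hlim i).mono_right (pure_le_nhds _)).limUnder_eq
  have hterm : (fun i : ℕ => (stableMultiplicity P i : ℝ) / (Fintype.card F : ℝ) ^ i) =
      fun i => ((PowerSeries.coeff i C : ℚ) : ℝ) * ((Fintype.card F : ℝ))⁻¹ ^ i := by
    funext i
    rw [hst, inv_pow, div_eq_mul_inv]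
  refine ⟨fun i => ?_, fun n => finite_maximalTorus, ?_, ?_⟩
  · rw [hst]
    exact Filter.tendsto_pure.1 (hlim i)
  · rw [hterm]
    exact hv.2.summable
  · rw [hterm, hv.2.tsum_eq]
    simpa only [normalized_sum_evalTorus] using ht
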